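/- **Setup.** Let $s:\mathbb R\to\mathbb R$ be any $C^\infty$ function with $s\equiv 0$ on $[0,\frac14]$, $s$ increasing on $[\frac14,\frac34]$, $s\equiv 1$ on $[\frac34,1]$, $s(\frac12)=\frac12$, $s'(\frac12)=2$ and $s''(\frac12)=0$. For $n\ge 1$ put $r_n=\frac1{\ln(n+1)}$, $\Delta r_n=r_n-r_{n+1}$, $A_n=\{z\in\mathbb C: r_{n+1}\le|z|\le r_n\}$ and $\chi_n(z)=s\big((|z|-r_{n+1})/\Delta r_n\big)$ for $z\in A_n$. For $r>0$ let $D_r=\{z\in\mathbb C:|z|\le r\}$, so that $D_{r_1}=\{0\}\cup\bigcup_{n\ge1}A_n$. Let $p(n)=n^2$, $F(0)=1$ and $F(n)=(\ln(n+2))^{2n-2}F(n-1)$ for $n\ge1$. Define $\mathbf u=(u^1,u^2):D_{r_1}\to\mathbb C^2$ by $\mathbf u(0)=0$ and, for $z\in A_n$ with $n$ even, $$u^1(z)=F(n)z^{p(n)},\qquad u^2(z)=\chi_n(z)F(n-1)z^{p(n-1)}+(1-\chi_n(z))F(n+1)z^{p(n+1)},$$ while for $z\in A_n$ with $n$ odd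 the two formulas are switched. (The formulas agree on the common circles.) With $\partial_z=\frac12(\partial_x-i\partial_y)$, $\partial_{\bar z}=\frac12(\partial_x+i\partial_y)$ and $\|\mathbf u_z\|^2=|u^1_z|^2+|u^2_z|^2$, put, for $i,j\in\{1,2\}$, $$q_{ij}(z)=\frac{u^i_{\bar z}(z)\,\overline{u^j_z(z)}}{\|\mathbf u_z(z)\|^2}\quad(z\in D_{r_1}\setminus\{0\}),\qquad q_{ij}(0)=0 .$$ (Derivatives at points of the circle $|z|=r_1$ are taken within $D_{r_1}$.) These are the entries of the coefficient matrix $\mathbf Q$ of the Beltrami-type system $\mathbf u_{\bar z}=\mathbf Q\,\mathbf u_z$. **Theorem.** 1. For all $i,j$, $q_{ij}\in C^\infty(D_{r_1}\setminus\{0\})\cap C^0(D_{r_1})$. 2. For all $i,j$, $q_{ij}$ vanishes to infinite order at $0$: $|z^{-k}q_{ij}(z)|\to0$ as $z\to0$ for every integer $k\ge0$. 3. For all $i,j$, the first partial derivatives exist at the origin and $\frac{\partial}{\partial x}q_{ij}(0)=\frac{\partial}{\partial y}q_{ij}(0)=0$. 4. For every $0<r<r_1$, $q_{22}$ is not Lipschitz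 on $D_r$. Moreover, the points $x_n=r_{n+1}+\frac12\Delta r_n$ tend to $0$, and along even $n$ the derivative $\partial_{\bar z}q_{22}(x_n)$ grows like $(\ln n)^3$: there are constants $0<c\le C$ such that $c(\ln n)^3\le|\partial_{\bar z}q_{22}(x_n)|\le C(\ln n)^3$ for all sufficiently large even $n$. -/

import Mathlib

open scoped ContDiff

noncomputable section

namespace FlatBeltrami

/-- The admissible radial cutoff profiles `s`: smooth on the line, `0` on `[0, 1/4]`,
increasing on `[1/4, 3/4]`, `1` on `[3/4, 1]`, with `s(1/2) = 1/2`, `s'(1/2) = 2`,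
`s''(1/2) = 0`. -/
structure IsCutoffProfile (s : ℝ → ℝ) : Prop where
  smooth : ContDiff ℝ ∞ s
  eq_zero : ∀ x ∈ Set.Icc (0 : ℝ) (1 / 4), s x = 0
  mono : MonotoneOn s (Set.Icc (1 / 4) (3 / 4))
  eq_one : ∀ x ∈ Set.Icc (3 / 4 : ℝ) 1, s x = 1
  half : s (1 / 2) = 1 / 2
  deriv_half : deriv s (1 / 2) = 2
  deriv_deriv_half : deriv (deriv s) (1 / 2) = 0

/-- The radii `r_n = 1 / ln (n + 1)`, for `n ≥ 1`. -/
def radius (n : ℕ) : ℝ := 1 / Real.log ((n : ℝ) + 1)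

/-- `Δr_n = r_n - r_{n+1}`. -/
def deltaRadius (n : ℕ) : ℝ := radius n - radius (n + 1)

/-- The closed disk `D_r` about the origin. -/
def disk (r : ℝ) : Set ℂ := {z | ‖z‖ ≤ r}

/-- The closed annulus `A_n = {r_{n+1} ≤ |z| ≤ r_n}`; for `n ≥ 1` these, together with `0`,
fill the disk `D_{r_1}`. -/
def annulus (n : ℕ) : Set ℂ := {z | radius (n + 1) ≤ ‖z‖ ∧ ‖z‖ ≤ radius n}

/-- The cutoff function `χ_n` on `A_n`. -/
def chi (s : ℝ → ℝ) (n : ℕ) (z : ℂ) : ℝ := s ((‖z‖ - radius (n + 1)) / deltaRadius n)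

/-- The exponents `p(n) = n ^ 2`. -/
def p (n : ℕ) : ℕ := n ^ 2

/-- The coefficients: `F(0) = F(1) = 1` and `F(n) = (ln (n + 2)) ^ (2 n - 2) * F(n - 1)`. -/
def F : ℕ → ℝ
  | 0 => 1
  | n + 1 => Real.log ((n : ℝ) + 3) ^ (2 * n) * F n

/-- The monomial `F(n) z ^ p(n)`. -/
def monomialPart (n : ℕ) (z : ℂ) : ℂ := (F n : ℂ) * z ^ p n

/-- The transition `χ_n F(n-1) z ^ p(n-1) + (1 - χ_n) F(n+1) z ^ p(n+1)`. -/
def blendPart (s : ℝ → ℝ) (n : ℕ) (z : ℂ) : ℂ :=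
  (chi s n z : ℂ) * monomialPart (n - 1) z + (1 - (chi s n z : ℂ)) * monomialPart (n + 1) z

/-- The pair of component formulas on `A_n`; the two roles are switched for odd `n`. -/
def piece (s : ℝ → ℝ) (n : ℕ) (z : ℂ) : Fin 2 → ℂ :=
  if Even n then ![monomialPart n z, blendPart s n z] else ![blendPart s n z, monomialPart n z]

/-- For `0 < |z| ≤ r_1`, the index `n ≥ 1` with `r_{n+1} < |z| ≤ r_n`, equivalently
`n + 1 ≤ exp (1 / |z|) < n + 2`. -/
def annulusIndex (z : ℂ) : ℕ := ⌊Real.exp (1 / ‖z‖)⌋₊ - 1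

/-- The map `u : D_{r_1} → ℂ²`. Only its values on `D_{r_1}` matter. -/
def u (s : ℝ → ℝ) (z : ℂ) : Fin 2 → ℂ := if z = 0 then 0 else piece s (annulusIndex z) z

/-- `∂f/∂z = (∂f/∂x - i ∂f/∂y) / 2` for a function on the disk `D_{r_1}`
(one-sided at the bounding circle, the usual derivative inside). -/
def dz (f : ℂ → ℂ) (z : ℂ) : ℂ :=
  (fderivWithin ℝ f (disk (radius 1)) z 1
    - Complex.I * fderivWithin ℝ f (disk (radius 1)) z Complex.I) / 2

/-- `∂f/∂z̄ = (∂f/∂x + i ∂f/∂y) / 2` for a function on the disk `D_{r_1}`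
(one-sided at the bounding circle, the usual derivative inside). -/
def dzbar (f : ℂ → ℂ) (z : ℂ) : ℂ :=
  (fderivWithin ℝ f (disk (radius 1)) z 1
    + Complex.I * fderivWithin ℝ f (disk (radius 1)) z Complex.I) / 2

/-- `‖u_z‖ ^ 2 = |u¹_z| ^ 2 + |u²_z| ^ 2`. -/
def normSqDz (s : ℝ → ℝ) (z : ℂ) : ℝ := ∑ k, ‖dz (fun w => u s w k) z‖ ^ 2

/-- The coefficient matrix `Q(z)`, with entries `u^i_{z̄} * conj (u^j_z) / ‖u_z‖ ^ 2` for
`z ≠ 0` and `Q(0) = 0`. The indices `1, 2` are `0, 1 : Fin 2` here. -/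
def q (s : ℝ → ℝ) (i j : Fin 2) (z : ℂ) : ℂ :=
  if z = 0 then 0
  else dzbar (fun w => u s w i) z * (starRingEnd ℂ) (dz (fun w => u s w j) z)
    / (normSqDz s z : ℂ)

/-- The midpoints `x_n = r_{n+1} + Δr_n / 2` of the annuli, on the positive real axis. -/
def midpoint (n : ℕ) : ℝ := radius (n + 1) + deltaRadius n / 2

lemma radius_pos {n : ℕ} (hn : 1 ≤ n) : 0 < radius n := by
  have : (1 : ℝ) ≤ n := by exact_mod_cast hn
  exact one_div_pos.2 (Real.log_pos (by linarith))

lemma radius_succ_lt {n : ℕ} (hn : 1 ≤ n) : radius (n + 1) < radius n := by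
  have h1 : (1 : ℝ) ≤ n := by exact_mod_cast hn
  unfold radius
  apply one_div_lt_one_div_of_lt (Real.log_pos (by linarith))
  apply Real.log_lt_log (by linarith)
  push_cast
  linarith

/-- On the half-open annulus the index is the expected one. -/
lemma annulusIndex_eq {n : ℕ} (hn : 1 ≤ n) {z : ℂ} (h1 : radius (n + 1) < ‖z‖)
    (h2 : ‖z‖ ≤ radius n) : annulusIndex z = n := by
  have hn' : (1 : ℝ) ≤ n := by exact_mod_cast hn
  have hr : 0 < radius (n + 1) := radius_pos (by omega)
  have hz : 0 < ‖z‖ := hr.trans h1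
  have hl : 0 < Real.log ((n : ℝ) + 1) := Real.log_pos (by linarith)
  have hl' : 0 < Real.log ((n : ℝ) + 2) := Real.log_pos (by linarith)
  have e1 : Real.log ((n : ℝ) + 1) ≤ 1 / ‖z‖ := by
    rw [le_div_iff₀ hz]
    rw [radius, le_div_iff₀ hl] at h2
    linarith
  have e2 : 1 / ‖z‖ < Real.log ((n : ℝ) + 2) := by
    rw [div_lt_iff₀ hz]
    have h1' : 1 / Real.log ((n : ℝ) + 2) < ‖z‖ := by
      have : ((n + 1 : ℕ) : ℝ) + 1 = (n : ℝ) + 2 := by push_cast; ring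
      rw [radius, this] at h1
      exact h1
    rw [div_lt_iff₀ hl'] at h1'
    linarith
  have f1 : ((n + 1 : ℕ) : ℝ) ≤ Real.exp (1 / ‖z‖) := by
    rw [Real.log_le_iff_le_exp (by linarith)] at e1
    exact_mod_cast e1
  have f2 : Real.exp (1 / ‖z‖) < ((n + 1 : ℕ) : ℝ) + 1 := by
    rw [Real.lt_log_iff_exp_lt (by linarith)] at e2
    push_cast
    linarith
  have : ⌊Real.exp (1 / ‖z‖)⌋₊ = n + 1 :=
    (Nat.floor_eq_iff (Real.exp_pos _).le).2 ⟨f1, f2⟩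
  rw [annulusIndex, this]
  omega

/-- The formulas of `A_n` hold on the whole closed annulus: those of `A_n` and `A_{n+1}` agree
on the common circle. -/
theorem u_eq_piece {s : ℝ → ℝ} (hs : IsCutoffProfile s) {n : ℕ} (hn : 1 ≤ n) {z : ℂ}
    (hz : z ∈ annulus n) : u s z = piece s n z := by
  obtain ⟨h1, h2⟩ := hz
  have hr : 0 < radius (n + 1) := radius_pos (by omega)
  have hz0 : z ≠ 0 := norm_pos_iff.1 (hr.trans_le h1)
  rw [u, if_neg hz0]
  rcases h1.lt_or_eq with h1 | h1
  · rw [annulusIndex_eq hn h1 h2]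
  · rw [annulusIndex_eq (n := n + 1) (by omega)
      (by rw [← h1]; exact radius_succ_lt (by omega)) h1.ge]
    have c0 : chi s n z = 0 := by
      rw [chi, ← h1, sub_self, zero_div]
      exact hs.eq_zero 0 (by norm_num)
    have c1 : chi s (n + 1) z = 1 := by
      have : deltaRadius (n + 1) ≠ 0 := by
        have := radius_succ_lt (n := n + 1) (by omega)
        rw [deltaRadius]
        linarith
      rw [chi, ← h1, ← deltaRadius, div_self this]
      exact hs.eq_one 1 (by norm_num)
    by_cases he : Even n
    · have : ¬ Even (n + 1) := by simpa [Nat.even_add_one] using he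
      simp [piece, he, this, blendPart, c0, c1]
    · have : Even (n + 1) := by simpa [Nat.even_add_one] using he
      simp [piece, he, this, blendPart, c0, c1]

end FlatBeltrami

end

/-!
Write `f_z` and `f_z̄` for the Wirtinger derivatives. On `A_n` one component of `u` is the monomial
`F(n) z ^ (n ^ 2)`, which is holomorphic with `∂/∂z` nowhere zero, and the other interpolates
between its two neighbours. The profile is constant near both ends of `[0, 1]`, so the formulas of
`A_n` extend to a neighbourhood of `A_n` in the disk (`u_eventuallyEq_piece`). Hence `u` is smooth
off the origin, `u_z` never vanishes there, and `Q` is smooth (`contDiffOn_q`).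

On `A_n` let `V` be the `∂/∂z̄` of the interpolating component and `U` the `∂/∂z` of the monomial.
Both `|u^j_z|` and `|U|` are at most `‖u_z‖`, so `|q_ij| ≤ |V| / |U|` (`norm_q_le`). The recursion
for `F` is made so that on `A_n` both neighbouring monomials are at most a constant times
`F(n) |z| ^ (n ^ 2) / |z|` (`norm_mul_norm_gap_le`). Differentiating the cutoff costs
`1 / Δr_n = O(n (ln n) ^ 2)` and `U` gains `n ^ 2`, so `Q = O((ln n) ^ 2 / n)` on `A_n`
(`exists_norm_q_le`). Since `n + 2 > exp (1 / |z|)` there, `Q` is flat at the origin, which gives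
continuity and the vanishing derivatives.

At the midpoint `x = x_n` of an even annulus write `W = ∂u²/∂z`. Then `q₂₂` is
`V W̄ / (|U| ^ 2 + |W| ^ 2)`, and all quantities are real. The dominant part of its `∂/∂z̄` is
`-V W_z̄ / W ^ 2`: with `A` the lower neighbouring monomial at `x`, one has `V ≈ A / Δr_n`,
`W ≈ n ^ 2 A / (2 x)`, `W_z̄ ≈ n ^ 2 A / (x Δr_n)` and `1 / Δr_n ≈ n / x ^ 2`, so this part is about
`-4 / x ^ 3`, where `x ≈ 1 / ln n`. The other terms are smaller because `|U| / |W| ≈ 2 x` and the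
Wronskian of `U` and `W` loses a factor `n` by cancellation. In rescaled variables the exact value
is an expression continuous at the limit point (`dzbar_q_midpoint`, `tendsto_rescaledDzbar`). So
`|∂q₂₂/∂z̄ (x_n)| / (ln n) ^ 3 → 4` along even `n` (`tendsto_dzbar_q_mul`), and a function with
unbounded `∂/∂z̄` near the origin is not Lipschitz there.
-/

namespace FlatBeltrami

open Complex ComplexConjugate Filter Topology

variable {s : ℝ → ℝ}

/-! ### Wirtinger derivatives -/

/-- The real-linear map `h ↦ a * h + b * conj h`. Every real-linear map `ℂ → ℂ` has this form. -/
noncomputable def wirtingerCLM (a b : ℂ) : ℂ →L[ℝ] ℂ :=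
  a • ContinuousLinearMap.id ℝ ℂ + b • (conjCLE : ℂ →L[ℝ] ℂ)

@[simp] lemma wirtingerCLM_apply (a b h : ℂ) : wirtingerCLM a b h = a * h + b * conj h := by
  simp [wirtingerCLM]

/-- `f` is real-differentiable at `z` with `∂f/∂z = a` and `∂f/∂z̄ = b`. -/
def HasWirtingerAt (f : ℂ → ℂ) (a b z : ℂ) : Prop := HasFDerivAt f (wirtingerCLM a b) z

namespace HasWirtingerAt

variable {f g : ℂ → ℂ} {a b c d z : ℂ}

lemma congr {a' b' : ℂ} (hf : HasWirtingerAt f a b z) (ha : a = a') (hb : b = b') :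
    HasWirtingerAt f a' b' z := by
  subst ha hb; exact hf

lemma const (k z : ℂ) : HasWirtingerAt (fun _ => k) 0 0 z := by
  refine (hasFDerivAt_const k z).congr_fderiv ?_
  ext h; simp

lemma id (z : ℂ) : HasWirtingerAt (fun w => w) 1 0 z := by
  refine (hasFDerivAt_id z).congr_fderiv ?_
  ext h; simp

lemma star (hf : HasWirtingerAt f a b z) :
    HasWirtingerAt (fun w => conj (f w)) (conj b) (conj a) z := by
  refine ((conjCLE : ℂ →L[ℝ] ℂ).hasFDerivAt.comp z hf).congr_fderiv ?_
  ext h; simp [add_comm]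

lemma add (hf : HasWirtingerAt f a b z) (hg : HasWirtingerAt g c d z) :
    HasWirtingerAt (fun w => f w + g w) (a + c) (b + d) z := by
  refine (HasFDerivAt.add hf hg).congr_fderiv ?_
  ext h; simp; ring

lemma sub (hf : HasWirtingerAt f a b z) (hg : HasWirtingerAt g c d z) :
    HasWirtingerAt (fun w => f w - g w) (a - c) (b - d) z := by
  refine (HasFDerivAt.sub hf hg).congr_fderiv ?_
  ext h; simp; ring

lemma mul (hf : HasWirtingerAt f a b z) (hg : HasWirtingerAt g c d z) :
    HasWirtingerAt (fun w => f w * g w) (a * g z + f z * c) (b * g z + f z * d) z := by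
  refine (HasFDerivAt.mul hf hg).congr_fderiv ?_
  ext h; simp; ring

lemma inv (hf : HasWirtingerAt f a b z) (h0 : f z ≠ 0) :
    HasWirtingerAt (fun w => (f w)⁻¹) (-a / f z ^ 2) (-b / f z ^ 2) z := by
  have h1 : HasFDerivAt (fun w : ℂ => w⁻¹) _ (f z) :=
    (hasDerivAt_inv h0).hasFDerivAt.restrictScalars ℝ
  refine (h1.comp z hf).congr_fderiv ?_
  ext h; simp; field_simp; ring

lemma div (hf : HasWirtingerAt f a b z) (hg : HasWirtingerAt g c d z) (h0 : g z ≠ 0) :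
    HasWirtingerAt (fun w => f w / g w) ((a * g z - f z * c) / g z ^ 2)
      ((b * g z - f z * d) / g z ^ 2) z := by
  have := hf.mul (hg.inv h0)
  simp only [← div_eq_mul_inv] at this
  convert this using 1 <;> field_simp <;> ring

lemma monomial (k z : ℂ) (m : ℕ) :
    HasWirtingerAt (fun w => k * w ^ m) (k * (m * z ^ (m - 1))) 0 z := by
  have h1 : HasFDerivAt (fun w : ℂ => k * w ^ m) _ z :=
    ((hasDerivAt_pow m z).const_mul k).hasFDerivAt.restrictScalars ℝ
  refine h1.congr_fderiv ?_
  ext h; simp; ring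

/-- The radial function `w ↦ h ‖w‖` has `∂/∂z = h' z̄ / (2 |z|)` and `∂/∂z̄ = h' z / (2 |z|)`. -/
lemma radial {h : ℝ → ℝ} {h' : ℝ} (hz : z ≠ 0) (hh : HasDerivAt h h' ‖z‖) :
    HasWirtingerAt (fun w => (h ‖w‖ : ℂ)) (h' * conj z / (2 * ‖z‖)) (h' * z / (2 * ‖z‖)) z := by
  have hn : ‖z‖ ≠ 0 := norm_ne_zero_iff.2 hz
  have h1 : HasFDerivAt (fun w : ℂ => ‖w‖ ^ 2) _ z := (hasStrictFDerivAt_norm_sq z).hasFDerivAt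
  have h2 := h1.sqrt (pow_ne_zero 2 hn)
  simp only [Real.sqrt_sq (norm_nonneg _)] at h2
  have h3 := ofRealCLM.hasFDerivAt.comp z (hh.comp_hasFDerivAt z h2)
  refine h3.congr_fderiv ?_
  ext w
  have e (ζ : ℂ) : h' * ζ / (2 * ‖z‖) = ((h' / (2 * ‖z‖) : ℝ) : ℂ) * ζ := by push_cast; ring
  simp only [ContinuousLinearMap.comp_apply, wirtingerCLM_apply, smul_apply,
    ofRealCLM_apply, innerSL_apply_apply, Complex.inner, smul_eq_mul, e]
  apply Complex.ext
  · simp [nsmul_eq_mul, -ofReal_div]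
    field_simp
    ring
  · simp [nsmul_eq_mul, -ofReal_div]
    field_simp
    ring

end HasWirtingerAt

lemma zero_lt_radius_one : 0 < radius 1 := radius_pos le_rfl

lemma uniqueDiffOn_disk {r : ℝ} (hr : 0 < r) : UniqueDiffOn ℝ (disk r) := by
  have : disk r = Metric.closedBall 0 r := by ext z; simp [disk]
  rw [this]
  exact uniqueDiffOn_convex (convex_closedBall _ _) (by
    rw [interior_closedBall _ hr.ne']; exact ⟨0, by simpa⟩)

lemma HasWirtingerAt.fderivWithin_disk {f g : ℂ → ℂ} {a b z : ℂ} (hg : HasWirtingerAt g a b z)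
    (hz : z ∈ disk (radius 1)) (hfg : f =ᶠ[𝓝[disk (radius 1)] z] g) :
    fderivWithin ℝ f (disk (radius 1)) z = wirtingerCLM a b := by
  rw [hfg.fderivWithin_eq (hfg.self_of_nhdsWithin hz)]
  exact hg.hasFDerivWithinAt.fderivWithin (uniqueDiffOn_disk zero_lt_radius_one z hz)

/-- The derivative `∂/∂z` within the disk is a Wirtinger derivative of any local representative. -/
lemma HasWirtingerAt.dz_eq {f g : ℂ → ℂ} {a b z : ℂ} (hg : HasWirtingerAt g a b z)
    (hz : z ∈ disk (radius 1)) (hfg : f =ᶠ[𝓝[disk (radius 1)] z] g) : dz f z = a := by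
  rw [dz, hg.fderivWithin_disk hz hfg]
  simp
  linear_combination ((b - a) / 2) * I_mul_I

/-- The derivative `∂/∂z̄` within the disk is a Wirtinger derivative of any local
representative. -/
lemma HasWirtingerAt.dzbar_eq {f g : ℂ → ℂ} {a b z : ℂ} (hg : HasWirtingerAt g a b z)
    (hz : z ∈ disk (radius 1)) (hfg : f =ᶠ[𝓝[disk (radius 1)] z] g) : dzbar f z = b := by
  rw [dzbar, hg.fderivWithin_disk hz hfg]
  simp
  linear_combination ((a - b) / 2) * I_mul_I

/-! ### Local representatives of `u` -/

/-- The profile `s` on `[0, 1]`, continued by the constants `0` and `1`. The formulas of `A_n`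
with this profile hold on a full neighbourhood of `A_n` in the disk. -/
noncomputable def extendedProfile (s : ℝ → ℝ) (x : ℝ) : ℝ :=
  if x < 1 / 4 then 0 else if x ≤ 3 / 4 then s x else 1

lemma extendedProfile_eq_zero {s : ℝ → ℝ} (hs : IsCutoffProfile s) {x : ℝ} (hx : x ≤ 1 / 4) :
    extendedProfile s x = 0 := by
  rcases hx.lt_or_eq with h | rfl
  · simp only [extendedProfile, if_pos h]
  · have := hs.eq_zero (1 / 4) (by norm_num)
    simpa [extendedProfile] using by norm_num at this ⊢; exact this

lemma extendedProfile_eq_one {s : ℝ → ℝ} (hs : IsCutoffProfile s) {x : ℝ} (hx : 3 / 4 ≤ x) :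
    extendedProfile s x = 1 := by
  have h1 : ¬ x < 1 / 4 := by linarith
  rcases hx.lt_or_eq with h | rfl
  · simp only [extendedProfile, if_neg h1, if_neg (not_le.2 h)]
  · simp only [extendedProfile, if_neg h1, if_pos le_rfl]
    exact hs.eq_one _ (by norm_num)

lemma extendedProfile_eq {s : ℝ → ℝ} (hs : IsCutoffProfile s) {x : ℝ} (h0 : 0 ≤ x) (h1 : x ≤ 1) :
    extendedProfile s x = s x := by
  rcases le_total x (1 / 4) with h | h
  · rw [extendedProfile_eq_zero hs h, hs.eq_zero x ⟨h0, h⟩]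
  rcases le_total x (3 / 4) with h' | h'
  · simp only [extendedProfile, if_neg (not_lt.2 h), if_pos h']
  · rw [extendedProfile_eq_one hs h', hs.eq_one x ⟨h', h1⟩]

lemma extendedProfile_eventuallyEq {s : ℝ → ℝ} (hs : IsCutoffProfile s) {x : ℝ} (h0 : 0 < x)
    (h1 : x < 1) : extendedProfile s =ᶠ[𝓝 x] s := by
  filter_upwards [Ioo_mem_nhds h0 h1] with y hy
  exact extendedProfile_eq hs hy.1.le hy.2.le

lemma contDiff_extendedProfile {s : ℝ → ℝ} (hs : IsCutoffProfile s) :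
    ContDiff ℝ ∞ (extendedProfile s) := by
  rw [contDiff_iff_contDiffAt]
  intro x
  rcases lt_or_ge x (1 / 4) with h | h
  · refine (contDiffAt_const (c := (0 : ℝ))).congr_of_eventuallyEq ?_
    filter_upwards [Iio_mem_nhds h] with y hy
    exact extendedProfile_eq_zero hs (le_of_lt hy)
  rcases lt_or_ge (3 / 4) x with h' | h'
  · refine (contDiffAt_const (c := (1 : ℝ))).congr_of_eventuallyEq ?_
    filter_upwards [Ioi_mem_nhds h'] with y hy
    exact extendedProfile_eq_one hs (le_of_lt hy)
  · exact hs.smooth.contDiffAt.congr_of_eventuallyEq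
      (extendedProfile_eventuallyEq hs (by linarith) (by linarith))

lemma deltaRadius_pos {n : ℕ} (hn : 1 ≤ n) : 0 < deltaRadius n := by
  have := radius_succ_lt hn
  rw [deltaRadius]; linarith

lemma radius_le_radius_one {n : ℕ} (hn : 1 ≤ n) : radius n ≤ radius 1 := by
  induction n, hn using Nat.le_induction with
  | base => exact le_rfl
  | succ n hn ih => exact (radius_succ_lt hn).le.trans ih

lemma annulus_subset_disk {n : ℕ} (hn : 1 ≤ n) {z : ℂ} (hz : z ∈ annulus n) :
    z ∈ disk (radius 1) := hz.2.trans (radius_le_radius_one hn)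

lemma ne_zero_of_mem_annulus {n : ℕ} (hn : 1 ≤ n) {z : ℂ} (hz : z ∈ annulus n) : z ≠ 0 :=
  norm_pos_iff.1 ((radius_pos (by omega)).trans_le hz.1)

/-- The index of the component that is a monomial on `A_n`. -/
def monomialIndex (n : ℕ) : Fin 2 := if Even n then 0 else 1

lemma piece_apply (s : ℝ → ℝ) (n : ℕ) (z : ℂ) (k : Fin 2) :
    piece s n z k = if k = monomialIndex n then monomialPart n z else blendPart s n z := by
  by_cases h : Even n <;> fin_cases k <;> simp [piece, monomialIndex, h]

lemma piece_congr {s t : ℝ → ℝ} {n : ℕ} {z : ℂ} (h : chi s n z = chi t n z) :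
    piece s n z = piece t n z := by
  simp [piece, blendPart, h]

/-- The formulas of `A_n` and `A_{n+1}` agree wherever the cutoffs are in their end states. -/
lemma piece_eq_piece_succ {s t : ℝ → ℝ} {n : ℕ} {z : ℂ} (h0 : chi s n z = 0)
    (h1 : chi t (n + 1) z = 1) : piece s n z = piece t (n + 1) z := by
  by_cases he : Even n
  · have : ¬ Even (n + 1) := by simpa [Nat.even_add_one] using he
    simp [piece, he, this, blendPart, h0, h1]
  · have : Even (n + 1) := by simpa [Nat.even_add_one] using he
    simp [piece, he, this, blendPart, h0, h1]

/-- The two closed annuli next to `A_n` begin with zones where their own cutoff is constant, so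
that the formulas of `A_n`, with the extended profile, remain valid there. -/
lemma u_eventuallyEq_piece {s : ℝ → ℝ} (hs : IsCutoffProfile s) {n : ℕ} (hn : 1 ≤ n) {z : ℂ}
    (hz : z ∈ annulus n) :
    u s =ᶠ[𝓝[disk (radius 1)] z] piece (extendedProfile s) n := by
  have hd := deltaRadius_pos hn
  have hd1 := deltaRadius_pos (n := n + 1) (by omega)
  have e1 : deltaRadius (n + 1) = radius (n + 1) - radius (n + 1 + 1) := rfl
  have e0 : deltaRadius n = radius n - radius (n + 1) := rfl
  have lo : ∀ᶠ w in 𝓝[disk (radius 1)] z,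
      radius (n + 1) - deltaRadius (n + 1) / 4 < ‖w‖ :=
    nhdsWithin_le_nhds (continuous_norm.continuousAt.eventually
      (lt_mem_nhds (by have := hz.1; linarith)))
  have hi : ∀ᶠ w in 𝓝[disk (radius 1)] z, 2 ≤ n → ‖w‖ < radius n + deltaRadius (n - 1) / 4 := by
    by_cases h2 : 2 ≤ n
    · have := deltaRadius_pos (n := n - 1) (by omega)
      have hlt : ‖z‖ < radius n + deltaRadius (n - 1) / 4 := by have := hz.2; linarith
      filter_upwards [nhdsWithin_le_nhds (continuous_norm.continuousAt.eventually
        (Iio_mem_nhds hlt))] with w hw _ using hw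
    · exact Eventually.of_forall fun w h => absurd h h2
  filter_upwards [lo, hi, self_mem_nhdsWithin] with w hlo hhi hw
  rcases lt_or_ge ‖w‖ (radius (n + 1)) with h1 | h1
  · rw [u_eq_piece hs (n := n + 1) (by omega) ⟨by linarith, h1.le⟩]
    refine (piece_eq_piece_succ ?_ (hs.eq_one _ ⟨?_, ?_⟩)).symm
    · refine extendedProfile_eq_zero hs ?_
      exact (div_nonpos_of_nonpos_of_nonneg (by linarith) hd.le).trans (by norm_num)
    · rw [le_div_iff₀ hd1]; linarith
    · rw [div_le_iff₀ hd1]; linarith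
  rcases le_or_gt ‖w‖ (radius n) with h2 | h2
  · rw [u_eq_piece hs hn ⟨h1, h2⟩]
    refine piece_congr (extendedProfile_eq hs (div_nonneg (by linarith) hd.le) ?_).symm
    rw [div_le_iff₀ hd]; linarith
  · obtain ⟨m, rfl⟩ : ∃ m, n = m + 1 := ⟨n - 1, by omega⟩
    have hm : 1 ≤ m := by
      -- `A_1` has no outer neighbour: its outer circle bounds the disk.
      by_contra hm
      obtain rfl : m = 0 := by omega
      exact absurd hw (not_le.2 h2)
    have hdm := deltaRadius_pos hm
    have em : deltaRadius m = radius m - radius (m + 1) := rfl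
    have hhi := hhi (by omega)
    rw [Nat.add_sub_cancel] at hhi
    rw [u_eq_piece hs hm ⟨h2.le, by linarith⟩]
    refine piece_eq_piece_succ (hs.eq_zero _ ⟨?_, ?_⟩) ?_
    · exact div_nonneg (by linarith) hdm.le
    · rw [div_le_iff₀ hdm]; linarith
    · refine extendedProfile_eq_one hs ?_
      rw [le_div_iff₀ hd]; linarith

lemma one_le_annulusIndex {z : ℂ} (hz : z ∈ disk (radius 1)) (h0 : z ≠ 0) :
    1 ≤ annulusIndex z := by
  have hn : 0 < ‖z‖ := norm_pos_iff.2 h0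
  have h1 : ‖z‖ ≤ 1 / Real.log 2 := by
    have : ‖z‖ ≤ radius 1 := hz
    rw [radius] at this; norm_num at this ⊢; exact this
  have h2 : Real.log 2 ≤ 1 / ‖z‖ := by
    rw [le_div_iff₀ hn]
    rw [le_div_iff₀ (Real.log_pos (by norm_num))] at h1
    linarith
  have h3 : ((2 : ℕ) : ℝ) ≤ Real.exp (1 / ‖z‖) := by
    rw [Real.log_le_iff_le_exp (by norm_num)] at h2
    exact_mod_cast h2
  have := Nat.le_floor h3
  rw [annulusIndex]; omega

lemma exp_lt_annulusIndex {z : ℂ} (hz : z ∈ disk (radius 1)) (h0 : z ≠ 0) :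
    Real.exp (1 / ‖z‖) < annulusIndex z + 2 := by
  have h1 := one_le_annulusIndex hz h0
  have h2 := Nat.lt_floor_add_one (Real.exp (1 / ‖z‖))
  have h3 : ((⌊Real.exp (1 / ‖z‖)⌋₊ : ℕ) : ℝ) = annulusIndex z + 1 := by
    have : ⌊Real.exp (1 / ‖z‖)⌋₊ = annulusIndex z + 1 := by rw [annulusIndex] at *; omega
    rw [this]; push_cast; ring
  linarith

lemma mem_annulus_annulusIndex {z : ℂ} (hz : z ∈ disk (radius 1)) (h0 : z ≠ 0) :
    z ∈ annulus (annulusIndex z) := by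
  have hn : 0 < ‖z‖ := norm_pos_iff.2 h0
  have h1 := one_le_annulusIndex hz h0
  have h1' : (1 : ℝ) ≤ annulusIndex z := by exact_mod_cast h1
  have h2 := exp_lt_annulusIndex hz h0
  have h3 : (annulusIndex z : ℝ) + 1 ≤ Real.exp (1 / ‖z‖) := by
    have : ⌊Real.exp (1 / ‖z‖)⌋₊ = annulusIndex z + 1 := by rw [annulusIndex] at *; omega
    have := Nat.floor_le (Real.exp_pos (1 / ‖z‖)).le
    simp_all
  constructor
  · have e : ((annulusIndex z + 1 : ℕ) : ℝ) + 1 = annulusIndex z + 2 := by push_cast; ring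
    rw [radius, e, div_le_iff₀ (Real.log_pos (by linarith)), ← div_le_iff₀' hn]
    exact ((Real.lt_log_iff_exp_lt (by linarith)).2 h2).le
  · rw [radius, le_div_iff₀ (Real.log_pos (by linarith)), ← le_div_iff₀' hn]
    exact (Real.log_le_iff_le_exp (by linarith)).2 h3

/-! ### Explicit derivatives on the annuli -/

/-- `∂/∂z` of `F(n) z ^ p(n)`. -/
noncomputable def monomialDz (n : ℕ) (z : ℂ) : ℂ := F n * (p n * z ^ (p n - 1))

/-- The radial derivative of `χ_n`, for a profile `t`. -/
noncomputable def chiDeriv (t : ℝ → ℝ) (n : ℕ) (r : ℝ) : ℝ :=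
  deriv t ((r - radius (n + 1)) / deltaRadius n) / deltaRadius n

/-- The difference of the two monomials that `blendPart` interpolates. -/
noncomputable def gap (n : ℕ) (z : ℂ) : ℂ := monomialPart (n - 1) z - monomialPart (n + 1) z

/-- `∂/∂z` of `blendPart`. -/
noncomputable def blendDz (t : ℝ → ℝ) (n : ℕ) (z : ℂ) : ℂ :=
  chiDeriv t n ‖z‖ * conj z / (2 * ‖z‖) * gap n z
    + (chi t n z * monomialDz (n - 1) z + (1 - chi t n z) * monomialDz (n + 1) z)

/-- `∂/∂z̄` of `blendPart`. -/
noncomputable def blendDzbar (t : ℝ → ℝ) (n : ℕ) (z : ℂ) : ℂ :=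
  chiDeriv t n ‖z‖ * z / (2 * ‖z‖) * gap n z

lemma hasWirtingerAt_monomialPart (n : ℕ) (z : ℂ) :
    HasWirtingerAt (monomialPart n) (monomialDz n z) 0 z :=
  HasWirtingerAt.monomial _ _ _

lemma hasWirtingerAt_gap (n : ℕ) (z : ℂ) :
    HasWirtingerAt (gap n) (monomialDz (n - 1) z - monomialDz (n + 1) z) 0 z := by
  have := (hasWirtingerAt_monomialPart (n - 1) z).sub (hasWirtingerAt_monomialPart (n + 1) z)
  rwa [sub_zero] at this

lemma hasWirtingerAt_chi {t : ℝ → ℝ} (ht : ContDiff ℝ ∞ t) (n : ℕ) {z : ℂ} (hz : z ≠ 0) :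
    HasWirtingerAt (fun w => (chi t n w : ℂ)) (chiDeriv t n ‖z‖ * conj z / (2 * ‖z‖))
      (chiDeriv t n ‖z‖ * z / (2 * ‖z‖)) z := by
  refine HasWirtingerAt.radial (h := fun r => t ((r - radius (n + 1)) / deltaRadius n)) hz ?_
  have h1 := (ht.differentiable (by simp)).differentiableAt
    (x := (‖z‖ - radius (n + 1)) / deltaRadius n) |>.hasDerivAt
  have h2 := h1.comp ‖z‖ (((hasDerivAt_id ‖z‖).sub_const (radius (n + 1))).div_const
    (deltaRadius n))
  simpa [chiDeriv, div_eq_mul_inv, Function.comp_def] using h2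

lemma hasWirtingerAt_blendPart {t : ℝ → ℝ} (ht : ContDiff ℝ ∞ t) (n : ℕ) {z : ℂ} (hz : z ≠ 0) :
    HasWirtingerAt (blendPart t n) (blendDz t n z) (blendDzbar t n z) z := by
  have hc := hasWirtingerAt_chi ht n hz
  have := (hc.mul (hasWirtingerAt_monomialPart (n - 1) z)).add
    (((HasWirtingerAt.const 1 z).sub hc).mul (hasWirtingerAt_monomialPart (n + 1) z))
  unfold blendPart
  convert this using 1
  · rw [blendDz, gap]; ring
  · rw [blendDzbar, gap]; ring

lemma u_apply_eventuallyEq (hs : IsCutoffProfile s) {n : ℕ} (hn : 1 ≤ n) {z : ℂ}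
    (hz : z ∈ annulus n) (k : Fin 2) :
    (fun w => u s w k) =ᶠ[𝓝[disk (radius 1)] z]
      if k = monomialIndex n then monomialPart n else blendPart (extendedProfile s) n := by
  filter_upwards [u_eventuallyEq_piece hs hn hz] with w hw
  rw [hw, piece_apply]
  split_ifs <;> rfl

lemma dz_u (hs : IsCutoffProfile s) {n : ℕ} (hn : 1 ≤ n) {z : ℂ} (hz : z ∈ annulus n)
    (k : Fin 2) : dz (fun w => u s w k) z =
      if k = monomialIndex n then monomialDz n z else blendDz (extendedProfile s) n z := by
  have h := u_apply_eventuallyEq hs hn hz k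
  have hd := annulus_subset_disk hn hz
  split_ifs at h ⊢
  · exact (hasWirtingerAt_monomialPart n z).dz_eq hd h
  · exact (hasWirtingerAt_blendPart (contDiff_extendedProfile hs) n
      (ne_zero_of_mem_annulus hn hz)).dz_eq hd h

lemma dzbar_u (hs : IsCutoffProfile s) {n : ℕ} (hn : 1 ≤ n) {z : ℂ} (hz : z ∈ annulus n)
    (k : Fin 2) : dzbar (fun w => u s w k) z =
      if k = monomialIndex n then 0 else blendDzbar (extendedProfile s) n z := by
  have h := u_apply_eventuallyEq hs hn hz k
  have hd := annulus_subset_disk hn hz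
  split_ifs at h ⊢
  · exact (hasWirtingerAt_monomialPart n z).dzbar_eq hd h
  · exact (hasWirtingerAt_blendPart (contDiff_extendedProfile hs) n
      (ne_zero_of_mem_annulus hn hz)).dzbar_eq hd h

lemma normSqDz_eq (hs : IsCutoffProfile s) {n : ℕ} (hn : 1 ≤ n) {z : ℂ} (hz : z ∈ annulus n) :
    normSqDz s z = ‖monomialDz n z‖ ^ 2 + ‖blendDz (extendedProfile s) n z‖ ^ 2 := by
  simp only [normSqDz, Fin.sum_univ_two, dz_u hs hn hz, monomialIndex]
  by_cases h : Even n <;> simp [h, add_comm]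

lemma F_pos (n : ℕ) : 0 < F n := by
  induction n with
  | zero => simp [F]
  | succ n ih =>
    rw [F]
    have : (0 : ℝ) ≤ n := n.cast_nonneg
    exact mul_pos (pow_pos (Real.log_pos (by linarith)) _) ih

lemma norm_monomialDz (n : ℕ) (z : ℂ) : ‖monomialDz n z‖ = F n * (p n * ‖z‖ ^ (p n - 1)) := by
  simp [monomialDz, abs_of_pos (F_pos n)]

lemma norm_monomialDz_pos {n : ℕ} (hn : 1 ≤ n) {z : ℂ} (hz : z ≠ 0) : 0 < ‖monomialDz n z‖ := by
  rw [norm_monomialDz]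
  have h1 := F_pos n
  have h2 : 0 < ‖z‖ := norm_pos_iff.2 hz
  have h3 : (0 : ℝ) < p n := by exact_mod_cast (by unfold p; positivity : 0 < p n)
  positivity

lemma normSqDz_pos (hs : IsCutoffProfile s) {z : ℂ} (hz : z ∈ disk (radius 1)) (h0 : z ≠ 0) :
    0 < normSqDz s z := by
  have h1 := one_le_annulusIndex hz h0
  rw [normSqDz_eq hs h1 (mem_annulus_annulusIndex hz h0)]
  have := norm_monomialDz_pos h1 h0
  positivity

/-! ### Smoothness away from the origin -/

lemma contDiffAt_blendPart {t : ℝ → ℝ} (ht : ContDiff ℝ ∞ t) (n : ℕ) {z : ℂ} (hz : z ≠ 0) :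
    ContDiffAt ℝ ∞ (blendPart t n) z := by
  have hm (k : ℕ) : ContDiffAt ℝ ∞ (monomialPart k) z := by
    unfold monomialPart; fun_prop
  have hc : ContDiffAt ℝ ∞ (fun w => (chi t n w : ℂ)) z := by
    refine ofRealCLM.contDiff.contDiffAt.comp z (ht.contDiffAt.comp z ?_)
    exact ((contDiffAt_norm ℝ hz).sub contDiffAt_const).div_const _
  exact (hc.mul (hm _)).add ((contDiffAt_const.sub hc).mul (hm _))

lemma contDiffOn_u_apply (hs : IsCutoffProfile s) (k : Fin 2) :
    ContDiffOn ℝ ∞ (fun z => u s z k) (disk (radius 1) \ {0}) := by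
  intro z hz
  have h1 := one_le_annulusIndex hz.1 hz.2
  have h2 := mem_annulus_annulusIndex hz.1 hz.2
  have h3 := u_apply_eventuallyEq hs h1 h2 k
  refine ContDiffWithinAt.congr_of_eventuallyEq (f := if k = monomialIndex (annulusIndex z) then
    monomialPart (annulusIndex z) else blendPart (extendedProfile s) (annulusIndex z)) ?_
    (h3.filter_mono (nhdsWithin_mono _ Set.sdiff_subset)) (h3.self_of_nhdsWithin hz.1)
  split_ifs
  · refine ContDiffAt.contDiffWithinAt ?_
    unfold monomialPart; fun_prop
  · exact (contDiffAt_blendPart (contDiff_extendedProfile hs) _ hz.2).contDiffWithinAt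

lemma contDiffOn_fderivWithin_u_apply (hs : IsCutoffProfile s) (k : Fin 2) :
    ContDiffOn ℝ ∞ (fderivWithin ℝ (fun z => u s z k) (disk (radius 1)))
      (disk (radius 1) \ {0}) := by
  have hU : UniqueDiffOn ℝ (disk (radius 1) \ {0}) :=
    (uniqueDiffOn_disk zero_lt_radius_one).inter isOpen_compl_singleton
  refine ((contDiffOn_u_apply hs k).fderivWithin hU (m := ∞) (by simp)).congr fun z hz => ?_
  exact (fderivWithin_inter (isOpen_compl_singleton.mem_nhds hz.2)).symm

lemma contDiffOn_q (hs : IsCutoffProfile s) (i j : Fin 2) :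
    ContDiffOn ℝ ∞ (q s i j) (disk (radius 1) \ {0}) := by
  have hD := contDiffOn_fderivWithin_u_apply hs
  have hz (k : Fin 2) : ContDiffOn ℝ ∞ (dz fun w => u s w k) (disk (radius 1) \ {0}) :=
    (((hD k).clm_apply contDiffOn_const).sub
      (contDiffOn_const.mul ((hD k).clm_apply contDiffOn_const))).div_const 2
  have hzb (k : Fin 2) : ContDiffOn ℝ ∞ (dzbar fun w => u s w k) (disk (radius 1) \ {0}) :=
    (((hD k).clm_apply contDiffOn_const).add
      (contDiffOn_const.mul ((hD k).clm_apply contDiffOn_const))).div_const 2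
  have hS : ContDiffOn ℝ ∞ (normSqDz s) (disk (radius 1) \ {0}) := by
    unfold normSqDz
    exact ContDiffOn.sum fun k _ => (hz k).norm_sq ℝ
  have hN : ContDiffOn ℝ ∞ (fun z => (normSqDz s z : ℂ)) (disk (radius 1) \ {0}) :=
    ofRealCLM.contDiff.comp_contDiffOn hS
  have hconj := (conjCLE : ℂ →L[ℝ] ℂ).contDiff (n := ∞).comp_contDiffOn (hz j)
  refine (((hzb i).mul hconj).mul (hN.inv fun z h => ?_)).congr fun z h => ?_
  · exact_mod_cast (normSqDz_pos hs h.1 h.2).ne'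
  · have : z ≠ 0 := h.2
    simp [q, this, div_eq_mul_inv]

/-! ### Flatness at the origin -/

/-- The recursion of the coefficients `F`, in the form that compares consecutive monomials. -/
lemma F_mul_pow_succ (n : ℕ) (r : ℝ) :
    F (n + 1) * r ^ (n + 1) ^ 2
      = F n * r ^ n ^ 2 * (r * Real.log ((n : ℝ) + 3)) ^ (2 * n) * r := by
  rw [F, show (n + 1) ^ 2 = n ^ 2 + 2 * n + 1 by ring, pow_succ, pow_add, mul_pow]
  ring

lemma log_succ_pos {n : ℕ} (hn : 1 ≤ n) : 0 < Real.log ((n : ℝ) + 1) := by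
  have : (1 : ℝ) ≤ n := by exact_mod_cast hn
  exact Real.log_pos (by linarith)

lemma log_add_le {n : ℕ} {c : ℝ} (hc : 0 ≤ c) :
    Real.log ((n : ℝ) + 1 + c) ≤ Real.log ((n : ℝ) + 1) + c / (n + 1) := by
  have h0 : (0 : ℝ) < (n : ℝ) + 1 := by positivity
  have h1 := Real.log_le_sub_one_of_pos (x := ((n : ℝ) + 1 + c) / (n + 1)) (by positivity)
  rw [Real.log_div (by positivity) h0.ne'] at h1
  have : ((n : ℝ) + 1 + c) / (n + 1) - 1 = c / (n + 1) := by field_simp; ring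
  linarith

/-- The powers in `F_mul_pow_succ` stay bounded on `A_n`: the base exceeds `1` by at most
`c / ((n + 1) ln (n + 1))`, and the exponent is `2 n`. -/
lemma pow_mul_log_le {n : ℕ} (hn : 1 ≤ n) {r c : ℝ} (hr : 0 ≤ r) (hrn : r ≤ radius n)
    (hc : 0 ≤ c) :
    (r * Real.log ((n : ℝ) + 1 + c)) ^ (2 * n) ≤ Real.exp (2 * c / Real.log ((n : ℝ) + 1)) := by
  have hl := log_succ_pos hn
  have h0 : (0 : ℝ) < (n : ℝ) + 1 := by positivity
  have h1 : r * Real.log ((n : ℝ) + 1 + c) ≤ c / ((n + 1) * Real.log ((n : ℝ) + 1)) + 1 := by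
    have h2 : Real.log ((n : ℝ) + 1) ≤ Real.log ((n : ℝ) + 1 + c) :=
      Real.log_le_log h0 (by linarith)
    calc r * Real.log ((n : ℝ) + 1 + c)
        ≤ 1 / Real.log ((n : ℝ) + 1) * (Real.log ((n : ℝ) + 1) + c / (n + 1)) :=
          mul_le_mul hrn (log_add_le hc) (by linarith) (by positivity)
      _ = _ := by field_simp; ring
  have h2 : 0 ≤ r * Real.log ((n : ℝ) + 1 + c) :=
    mul_nonneg hr (Real.log_nonneg (by
      have : (0 : ℝ) ≤ n := n.cast_nonneg
      linarith))
  calc (r * Real.log ((n : ℝ) + 1 + c)) ^ (2 * n)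
      ≤ Real.exp (c / ((n + 1) * Real.log ((n : ℝ) + 1))) ^ (2 * n) :=
        pow_le_pow_left₀ h2 (h1.trans (Real.add_one_le_exp _)) _
    _ = Real.exp ((2 * c / Real.log ((n : ℝ) + 1)) * (n / (n + 1))) := by
        rw [← Real.exp_nat_mul]; congr 1; push_cast; field_simp
    _ ≤ _ := by
        apply Real.exp_le_exp.2
        apply mul_le_of_le_one_right (by positivity)
        rw [div_le_one h0]; linarith

lemma radius_succ_eq (n : ℕ) : radius (n + 1) = 1 / Real.log ((n : ℝ) + 2) := by
  rw [radius]; push_cast; ring_nf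

lemma one_le_mul_log {n : ℕ} {r : ℝ} (hr : radius (n + 1) ≤ r) :
    1 ≤ r * Real.log ((n : ℝ) + 2) := by
  have : (0 : ℝ) ≤ n := n.cast_nonneg
  rw [radius_succ_eq] at hr
  exact (div_le_iff₀ (Real.log_pos (by linarith))).1 hr

lemma deltaRadius_eq {n : ℕ} (hn : 1 ≤ n) : deltaRadius n =
    (Real.log ((n : ℝ) + 2) - Real.log ((n : ℝ) + 1))
      / (Real.log ((n : ℝ) + 1) * Real.log ((n : ℝ) + 2)) := by
  have h1 := log_succ_pos hn
  have h2 := log_succ_pos (n := n + 1) (by omega)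
  have e : ((n + 1 : ℕ) : ℝ) + 1 = n + 2 := by push_cast; ring
  rw [e] at h2
  rw [deltaRadius, radius_succ_eq, radius]
  field_simp

lemma one_div_le_log_sub_log (n : ℕ) :
    1 / ((n : ℝ) + 2) ≤ Real.log ((n : ℝ) + 2) - Real.log ((n : ℝ) + 1) := by
  have h1 := Real.log_le_sub_one_of_pos (x := ((n : ℝ) + 1) / (n + 2)) (by positivity)
  rw [Real.log_div (by positivity) (by positivity)] at h1
  have : ((n : ℝ) + 1) / (n + 2) - 1 = - (1 / (n + 2)) := by field_simp; ring
  linarith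

lemma one_div_deltaRadius_le {n : ℕ} (hn : 1 ≤ n) :
    1 / deltaRadius n ≤ (n + 2) * Real.log ((n : ℝ) + 2) ^ 2 := by
  have h1 := log_succ_pos hn
  have h12 : Real.log ((n : ℝ) + 1) ≤ Real.log ((n : ℝ) + 2) :=
    Real.log_le_log (by positivity) (by linarith)
  have h3 := one_div_le_log_sub_log n
  have h4 : (0 : ℝ) < 1 / ((n : ℝ) + 2) := by positivity
  rw [deltaRadius_eq hn, one_div_div, div_le_iff₀ (by linarith)]
  calc Real.log ((n : ℝ) + 1) * Real.log ((n : ℝ) + 2)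
      ≤ Real.log ((n : ℝ) + 2) ^ 2 := by
        rw [sq]; exact mul_le_mul_of_nonneg_right h12 (by linarith)
    _ = (n + 2) * Real.log ((n : ℝ) + 2) ^ 2 * (1 / (n + 2)) := by field_simp
    _ ≤ _ := mul_le_mul_of_nonneg_left h3 (by positivity)

lemma norm_monomialPart (n : ℕ) (z : ℂ) : ‖monomialPart n z‖ = F n * ‖z‖ ^ n ^ 2 := by
  simp [monomialPart, p, abs_of_pos (F_pos n)]

/-- Each interpolated monomial is compared with `F(n) |z| ^ (n ^ 2)` by one step of
`F_mul_pow_succ`: the power there is at least `1` for the lower one (`one_le_mul_log`) and bounded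
for the upper one (`pow_mul_log_le`). -/
lemma norm_mul_norm_gap_le {n : ℕ} (hn : 1 ≤ n) {z : ℂ} (hz : z ∈ annulus n) :
    ‖z‖ * ‖gap n z‖ ≤
      (1 + radius 1 ^ 2 * Real.exp (4 / Real.log 2)) * (F n * ‖z‖ ^ n ^ 2) := by
  set r := ‖z‖ with hr
  have hr0 : 0 < r := (radius_pos (by omega)).trans_le hz.1
  obtain ⟨m, rfl⟩ : ∃ m, n = m + 1 := ⟨n - 1, by omega⟩
  have hM : 0 < F (m + 1) * r ^ (m + 1) ^ 2 := mul_pos (F_pos _) (pow_pos hr0 _)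
  have hA : F m * r ^ m ^ 2 * r ≤ F (m + 1) * r ^ (m + 1) ^ 2 := by
    rw [F_mul_pow_succ]
    have h1 := one_le_mul_log hz.1
    have e : ((m + 1 : ℕ) : ℝ) + 2 = m + 3 := by push_cast; ring
    rw [e] at h1
    have h2 := one_le_pow₀ (n := 2 * m) h1
    have h3 : 0 ≤ F m * r ^ m ^ 2 * r := by have := F_pos m; positivity
    nlinarith
  have hB : F (m + 2) * r ^ (m + 2) ^ 2 * r
      ≤ radius 1 ^ 2 * Real.exp (4 / Real.log 2) * (F (m + 1) * r ^ (m + 1) ^ 2) := by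
    rw [F_mul_pow_succ (m + 1)]
    have h1 := pow_mul_log_le hn hr0.le hz.2 (c := 2) (by norm_num)
    have e : ((m + 1 : ℕ) : ℝ) + 1 + 2 = (m + 1 : ℕ) + 3 := by ring
    rw [e] at h1
    have h2 : Real.exp (2 * 2 / Real.log (((m + 1 : ℕ) : ℝ) + 1)) ≤ Real.exp (4 / Real.log 2) := by
      apply Real.exp_le_exp.2
      norm_num
      refine div_le_div_of_nonneg_left (by norm_num) (Real.log_pos (by norm_num)) ?_
      exact Real.log_le_log (by norm_num) (by have : (0 : ℝ) ≤ m := m.cast_nonneg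
                                              linarith)
    have h3 : r ^ 2 ≤ radius 1 ^ 2 := pow_le_pow_left₀ hr0.le (annulus_subset_disk hn hz) 2
    calc _ = r ^ 2 * (r * Real.log (((m + 1 : ℕ) : ℝ) + 3)) ^ (2 * (m + 1))
          * (F (m + 1) * r ^ (m + 1) ^ 2) := by ring
      _ ≤ _ := by
        refine mul_le_mul_of_nonneg_right ?_ hM.le
        exact mul_le_mul h3 (h1.trans h2) (by
          rw [pow_mul]; positivity) (by positivity)
  calc r * ‖gap (m + 1) z‖ ≤ r * (F m * r ^ m ^ 2 + F (m + 2) * r ^ (m + 2) ^ 2) := by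
        refine mul_le_mul_of_nonneg_left ?_ hr0.le
        refine (norm_sub_le _ _).trans (le_of_eq ?_)
        rw [norm_monomialPart, norm_monomialPart, Nat.add_sub_cancel]
    _ ≤ _ := by nlinarith

lemma norm_q_le (hs : IsCutoffProfile s) {n : ℕ} (hn : 1 ≤ n) {z : ℂ} (hz : z ∈ annulus n)
    (i j : Fin 2) :
    ‖q s i j z‖ ≤ ‖blendDzbar (extendedProfile s) n z‖ / ‖monomialDz n z‖ := by
  have h0 := ne_zero_of_mem_annulus hn hz
  have hU := norm_monomialDz_pos hn h0
  have hS : normSqDz s z = _ := normSqDz_eq hs hn hz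
  have hSpos : 0 < normSqDz s z := normSqDz_pos hs (annulus_subset_disk hn hz) h0
  have h1 : ‖dzbar (fun w => u s w i) z‖ ≤ ‖blendDzbar (extendedProfile s) n z‖ := by
    rw [dzbar_u hs hn hz]; split_ifs <;> simp
  have h2 : ‖dz (fun w => u s w j) z‖ * ‖monomialDz n z‖ ≤ normSqDz s z := by
    rw [dz_u hs hn hz, hS]
    split_ifs
    · nlinarith [sq_nonneg ‖blendDz (extendedProfile s) n z‖]
    · nlinarith [sq_nonneg (‖blendDz (extendedProfile s) n z‖ - ‖monomialDz n z‖),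
        sq_nonneg ‖blendDz (extendedProfile s) n z‖]
  rw [q, if_neg h0, norm_div, norm_mul, RCLike.norm_conj, norm_real, Real.norm_eq_abs,
    abs_of_pos hSpos, div_le_div_iff₀ hSpos hU, mul_assoc]
  exact mul_le_mul h1 h2 (by positivity) (norm_nonneg _)

/-- The decay of `Q`: since `n + 2 > exp (1 / |z|)` on `A_n`, this is flatness. -/
lemma exists_norm_q_le (hs : IsCutoffProfile s) : ∃ C : ℝ, ∀ n : ℕ, 1 ≤ n → ∀ z ∈ annulus n,
    ∀ i j, ‖q s i j z‖ ≤ C * (Real.log ((n : ℝ) + 2) ^ 2 / (n + 2)) := by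
  obtain ⟨K, hK⟩ := isCompact_Icc.exists_bound_of_continuousOn (s := Set.Icc (0 : ℝ) 1)
    ((contDiff_extendedProfile hs).continuous_deriv (by simp)).continuousOn
  have hK0 : 0 ≤ K := (norm_nonneg _).trans (hK 0 (by simp))
  refine ⟨K * (1 + radius 1 ^ 2 * Real.exp (4 / Real.log 2)) * 9 / 2, fun n hn z hz i j =>
    (norm_q_le hs hn hz i j).trans ?_⟩
  set E := 1 + radius 1 ^ 2 * Real.exp (4 / Real.log 2) with hE
  have hE0 : 0 < E := by positivity
  have h0 := ne_zero_of_mem_annulus hn hz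
  have hr : 0 < ‖z‖ := norm_pos_iff.2 h0
  have hd := deltaRadius_pos hn
  have hM : 0 < F n * ‖z‖ ^ n ^ 2 := mul_pos (F_pos _) (pow_pos hr _)
  have hn' : (1 : ℝ) ≤ n := by exact_mod_cast hn
  have h1 : |chiDeriv (extendedProfile s) n ‖z‖|
      ≤ K * ((n + 2) * Real.log ((n : ℝ) + 2) ^ 2) := by
    rw [chiDeriv, abs_div, abs_of_pos hd, div_eq_mul_one_div]
    refine mul_le_mul (hK _ ⟨?_, ?_⟩) (one_div_deltaRadius_le hn) (by positivity) hK0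
    · exact div_nonneg (sub_nonneg.2 hz.1) hd.le
    · rw [div_le_one hd, deltaRadius]; have := hz.2; linarith
  have h2 : ‖blendDzbar (extendedProfile s) n z‖
      = |chiDeriv (extendedProfile s) n ‖z‖| / 2 * ‖gap n z‖ := by
    simp only [blendDzbar, norm_mul, norm_div, norm_real, Real.norm_eq_abs, abs_norm,
      RCLike.norm_ofNat]
    field_simp
  have h3 : ‖monomialDz n z‖ * ‖z‖ = n ^ 2 * (F n * ‖z‖ ^ n ^ 2) := by
    rw [norm_monomialDz]
    have : ‖z‖ ^ n ^ 2 = ‖z‖ ^ (p n - 1) * ‖z‖ := by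
      rw [← pow_succ, Nat.sub_add_cancel]
      · rfl
      · unfold p; exact Nat.one_le_pow _ _ hn
    rw [this, p]; push_cast; ring
  have h4 := norm_mul_norm_gap_le hn hz
  have hl : 0 ≤ Real.log ((n : ℝ) + 2) := Real.log_nonneg (by linarith)
  rw [h2, ← mul_div_mul_right _ _ hr.ne', h3, div_le_iff₀ (by positivity)]
  calc |chiDeriv (extendedProfile s) n ‖z‖| / 2 * ‖gap n z‖ * ‖z‖
      = |chiDeriv (extendedProfile s) n ‖z‖| / 2 * (‖z‖ * ‖gap n z‖) := by ring
    _ ≤ (K * ((n + 2) * Real.log ((n : ℝ) + 2) ^ 2)) / 2 * (E * (F n * ‖z‖ ^ n ^ 2)) := by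
        refine mul_le_mul (by linarith) h4 (by positivity) (by positivity)
    _ = K * E / 2 * (Real.log ((n : ℝ) + 2) ^ 2 / (n + 2)) * (F n * ‖z‖ ^ n ^ 2)
          * (n + 2) ^ 2 := by field_simp
    _ ≤ K * E / 2 * (Real.log ((n : ℝ) + 2) ^ 2 / (n + 2)) * (F n * ‖z‖ ^ n ^ 2)
          * (9 * n ^ 2) := by
        refine mul_le_mul_of_nonneg_left ?_ (by positivity)
        nlinarith
    _ = _ := by ring

lemma disk_mem_nhds_zero {r : ℝ} (hr : 0 < r) : disk r ∈ 𝓝 (0 : ℂ) := by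
  have : disk r = Metric.closedBall 0 r := by ext z; simp [disk]
  rw [this]; exact Metric.closedBall_mem_nhds _ hr

lemma tendsto_zpow_mul_q (hs : IsCutoffProfile s) (i j : Fin 2) (k : ℕ) :
    Tendsto (fun z : ℂ => ‖z ^ (-(k : ℤ)) * q s i j z‖) (𝓝[≠] 0) (𝓝 0) := by
  obtain ⟨C, hC⟩ := exists_norm_q_le hs
  have hC0 : ∀ᶠ z in 𝓝[≠] (0 : ℂ), z ∈ disk (radius 1) ∧ z ≠ 0 :=
    Filter.Eventually.and (nhdsWithin_le_nhds (disk_mem_nhds_zero zero_lt_radius_one))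
      self_mem_nhdsWithin
  -- With `y = ln (n + 2)` the bound is `y ^ k * (y ^ 2 * exp (-y))`, and `y > 1 / |z|`.
  let y : ℂ → ℝ := fun z => Real.log ((annulusIndex z : ℝ) + 2)
  have hy : Tendsto y (𝓝[≠] 0) atTop := by
    refine tendsto_atTop_mono' _ ?_
      ((tendsto_inv_nhdsGT_zero (𝕜 := ℝ)).comp tendsto_norm_nhdsNE_zero)
    filter_upwards [hC0] with z hz
    rw [Function.comp_apply, inv_eq_one_div]
    exact ((Real.lt_log_iff_exp_lt (by positivity)).2 (exp_lt_annulusIndex hz.1 hz.2)).le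
  have hlim : Tendsto (fun z => |C| * (y z ^ (k + 2) * Real.exp (-y z))) (𝓝[≠] 0) (𝓝 0) := by
    simpa using ((Real.tendsto_pow_mul_exp_neg_atTop_nhds_zero (k + 2)).comp hy).const_mul |C|
  refine squeeze_zero' (Eventually.of_forall fun z => norm_nonneg _) ?_ hlim
  filter_upwards [hC0] with z ⟨hz, h0⟩
  have hn := one_le_annulusIndex hz h0
  have hA := mem_annulus_annulusIndex hz h0
  have hr : 0 < ‖z‖ := norm_pos_iff.2 h0
  have hN : (0 : ℝ) < (annulusIndex z : ℝ) + 2 := by positivity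
  have h1 := hC _ hn z hA i j
  have h2 : ‖z ^ (-(k : ℤ))‖ ≤ y z ^ k := by
    rw [zpow_neg, zpow_natCast, norm_inv, norm_pow, ← inv_pow]
    refine pow_le_pow_left₀ (by positivity) ?_ k
    rw [inv_le_iff_one_le_mul₀ hr, mul_comm]
    exact one_le_mul_log hA.1
  have hy0 : 0 ≤ y z := Real.log_nonneg (by
    have : (0 : ℝ) ≤ annulusIndex z := Nat.cast_nonneg _
    linarith)
  have h3 : Real.exp (-y z) = 1 / ((annulusIndex z : ℝ) + 2) := by
    rw [Real.exp_neg, Real.exp_log hN, one_div]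
  rw [norm_mul]
  calc ‖z ^ (-(k : ℤ))‖ * ‖q s i j z‖
      ≤ y z ^ k * (|C| * (y z ^ 2 / ((annulusIndex z : ℝ) + 2))) := by
        refine mul_le_mul h2 (h1.trans ?_) (norm_nonneg _) (by positivity)
        exact mul_le_mul_of_nonneg_right (le_abs_self C) (by positivity)
    _ = _ := by rw [h3]; ring

lemma continuousOn_q (hs : IsCutoffProfile s) (i j : Fin 2) :
    ContinuousOn (q s i j) (disk (radius 1)) := by
  intro z hz
  by_cases h0 : z = 0
  · subst h0
    refine ContinuousAt.continuousWithinAt ?_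
    have hq : q s i j 0 = 0 := by simp [q]
    rw [continuousAt_iff_punctured_nhds, hq]
    simpa using tendsto_zero_iff_norm_tendsto_zero.2 (tendsto_zpow_mul_q hs i j 0)
  · have h := (contDiffOn_q hs i j).continuousOn z ⟨hz, h0⟩
    refine h.mono_of_mem_nhdsWithin ?_
    exact inter_mem_nhdsWithin _ (isOpen_compl_singleton.mem_nhds h0)

/-- Flatness to first order gives vanishing derivatives along every line through the origin. -/
lemma hasDerivAt_q_comp (hs : IsCutoffProfile s) (i j : Fin 2) {c : ℂ} (hc : c ≠ 0) :
    HasDerivAt (fun t : ℝ => q s i j (t * c)) 0 0 := by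
  rw [hasDerivAt_iff_tendsto_slope]
  have h := tendsto_zero_iff_norm_tendsto_zero.2 (tendsto_zpow_mul_q hs i j 1)
  have hl : Tendsto (fun t : ℝ => (t : ℂ) * c) (𝓝[≠] 0) (𝓝[≠] 0) := by
    refine tendsto_nhdsWithin_iff.2 ⟨?_, ?_⟩
    · have : Continuous fun t : ℝ => (t : ℂ) * c := by fun_prop
      simpa using (this.tendsto 0).mono_left nhdsWithin_le_nhds
    · filter_upwards [self_mem_nhdsWithin] with t ht
      have : t ≠ 0 := ht
      simp [this, hc]
  have h' := (h.comp hl).const_mul c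
  rw [mul_zero] at h'
  refine h'.congr' ?_
  filter_upwards [self_mem_nhdsWithin] with t ht
  have ht' : (t : ℂ) ≠ 0 := by exact_mod_cast (show t ≠ 0 from ht)
  have hq : q s i j 0 = 0 := by simp [q]
  simp [slope, hq]
  field_simp

/-! ### The derivative of the quotient `q₂₂` in rescaled variables -/

/-- `∂/∂z̄` of the quotient that defines `q₂₂`, at a point where all data are real; the monomial
component, whose `∂/∂z` is `U`, is holomorphic. -/
lemma hasWirtingerAt_quotient {V W U : ℂ → ℂ} {z : ℂ} {v vz vb w wz wb m mz : ℝ}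
    (hV : HasWirtingerAt V vz vb z) (hW : HasWirtingerAt W wz wb z)
    (hU : HasWirtingerAt U mz 0 z) (v0 : V z = v) (w0 : W z = w) (m0 : U z = m) (hm : m ≠ 0) :
    ∃ a, HasWirtingerAt (fun z => V z * conj (W z) / (U z * conj (U z) + W z * conj (W z))) a
      (((vb * w + v * wz) * (m ^ 2 + w ^ 2) - v * w * (m * mz + wb * w + w * wz))
        / (m ^ 2 + w ^ 2) ^ 2 : ℝ) z := by
  have hS : m * m + w * w ≠ 0 := by
    have : 0 < m * m := mul_self_pos.2 hm
    nlinarith [mul_self_nonneg w]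
  have h := (hV.mul hW.star).div ((hU.mul hU.star).add (hW.mul hW.star)) (by
    simp only [w0, m0, conj_ofReal]; exact_mod_cast hS)
  refine ⟨_, h.congr rfl ?_⟩
  simp only [v0, w0, m0, conj_ofReal]
  push_cast
  ring

/-- The value of `∂/∂z̄` of the quotient in rescaled variables: `A = α M / x`, `B = b M x`,
`D = d n / x ^ 2`, `e = 1 / n` and `g = 1 / (n x)`, where `A`, `M`, `B` are the three consecutive
monomials and `D = 1 / Δr_n`. -/
noncomputable def rescaledDzbar (α b d x e g : ℝ) : ℝ :=
  let δ := d * (α - b * x ^ 2)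
  let θ := δ * g + (α * (1 - e) ^ 2 + b * x ^ 2 * (1 + e) ^ 2) / 2
  let σ := x ^ 2 + θ ^ 2
  let η := (α - b * x ^ 2) * e ^ 2 / 2 + (α * (1 - e) ^ 2 - b * x ^ 2 * (1 + e) ^ 2)
  let τ := -(δ * e ^ 2 / 2) + 2 * d * (α * (1 - e) ^ 2 - b * x ^ 2 * (1 + e) ^ 2)
    - (1 - e ^ 2) * δ
    + x / 2 * (α * (1 - e) ^ 2 * (-2 + e) + b * x ^ 2 * (1 + e) ^ 2 * (2 + e))
  δ * τ / σ ^ 2 * x ^ 2 - δ * θ / (2 * σ) * (x * e) - δ * θ ^ 2 * d * η / σ ^ 2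

/-- The numerator is split as `v_z̄ w (m² + w²) + v m (w_z m - w m_z) - v w² w_z̄`. In the Wronskian
`w_z m - w m_z` the leading parts `w_z ≈ n² w / x` and `m_z ≈ n² m / x` cancel, which is why `wz`
is written as `(n² - 1) w / x` plus a lower order term. The last summand carries the growth. -/
lemma rescaledDzbar_spec {α b d x n M : ℝ} (hx : x ≠ 0) (hn : n ≠ 0) (hM : M ≠ 0)
    {A B D v vb w wz wb m mz : ℝ} (hA : A = α * M / x) (hB : B = b * M * x)
    (hD : D = d * n / x ^ 2)
    (hv : v = D * (A - B)) (hvb : vb = -(D / (2 * x)) * (A - B))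
    (hw : w = D * (A - B) + ((n - 1) ^ 2 * A + (n + 1) ^ 2 * B) / (2 * x))
    (hwz : wz = -(D / (2 * x)) * (A - B) + 2 * D * ((n - 1) ^ 2 * A - (n + 1) ^ 2 * B) / x
      + ((n - 1) ^ 2 * ((n - 1) ^ 2 - 1) * A + (n + 1) ^ 2 * ((n + 1) ^ 2 - 1) * B)
        / (2 * x ^ 2))
    (hwb : wb = D / (2 * x) * (A - B) + D * ((n - 1) ^ 2 * A - (n + 1) ^ 2 * B) / x)
    (hm : m = n ^ 2 * M / x) (hmz : mz = n ^ 2 * (n ^ 2 - 1) * M / x ^ 2) :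
    ((vb * w + v * wz) * (m ^ 2 + w ^ 2) - v * w * (m * mz + wb * w + w * wz))
      / (m ^ 2 + w ^ 2) ^ 2 * x ^ 3 = rescaledDzbar α b d x (1 / n) (1 / (n * x)) := by
  unfold rescaledDzbar
  extract_lets δ θ σ η τ
  have e1 : v = M * n / x ^ 3 * δ := by
    rw [hv, hA, hB, hD]; simp only [δ]; field_simp
  have e2 : vb = -(M * n / (2 * x ^ 4)) * δ := by
    rw [hvb, hA, hB, hD]; simp only [δ]; field_simp
  have e3 : w = M * n ^ 2 / x ^ 2 * θ := by
    rw [hw, hA, hB, hD]; simp only [θ, δ]; field_simp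
  have e4 : wb = M * d * n ^ 3 / x ^ 4 * η := by
    rw [hwb, hA, hB, hD]; simp only [η]; field_simp
  have e5 : wz = (n ^ 2 - 1) / x * w + M * n ^ 3 / x ^ 4 * τ := by
    rw [hwz, hw, hA, hB, hD]; simp only [τ, δ]; field_simp; ring
  have hσ : 0 < σ := by
    have : 0 < x ^ 2 := by positivity
    simp only [σ]; positivity
  have e6 : m ^ 2 + w ^ 2 = M ^ 2 * n ^ 4 / x ^ 4 * σ := by
    rw [hm, e3]; simp only [σ]; field_simp
  have e7 : θ ^ 2 = σ - x ^ 2 := by simp only [σ]; ring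
  clear_value δ θ σ η τ
  have hσ' := hσ.ne'
  have key : ((vb * w + v * wz) * (m ^ 2 + w ^ 2) - v * w * (m * mz + wb * w + w * wz))
      = vb * w * (m ^ 2 + w ^ 2) + v * m * (wz * m - w * mz) - v * w ^ 2 * wb := by ring
  have e8 : wz * m - w * mz = M ^ 2 * n ^ 5 / x ^ 5 * τ := by
    rw [e5, hm, hmz]; field_simp; ring
  rw [key, e8, e6, e1, e2, e3, e4, hm]
  field_simp
  ring

/-- In the limit `δ = d = η = 1`, `θ = 1/2` and `σ = 1/4`, so that `-δ θ² d η / σ² = -4`. -/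
lemma tendsto_rescaledDzbar {ι : Type*} {l : Filter ι} {α b d x e g : ι → ℝ}
    (hα : Tendsto α l (𝓝 1)) (hb : Tendsto b l (𝓝 1)) (hd : Tendsto d l (𝓝 1))
    (hx : Tendsto x l (𝓝 0)) (he : Tendsto e l (𝓝 0)) (hg : Tendsto g l (𝓝 0)) :
    Tendsto (fun i => rescaledDzbar (α i) (b i) (d i) (x i) (e i) (g i)) l (𝓝 (-4)) := by
  have hc : ContinuousAt (fun y : ℝ × ℝ × ℝ × ℝ × ℝ × ℝ =>
      rescaledDzbar y.1 y.2.1 y.2.2.1 y.2.2.2.1 y.2.2.2.2.1 y.2.2.2.2.2) (1, 1, 1, 0, 0, 0) := by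
    unfold rescaledDzbar
    fun_prop (disch := norm_num)
  have h := hc.tendsto.comp
    (hα.prodMk_nhds (hb.prodMk_nhds (hd.prodMk_nhds (hx.prodMk_nhds (he.prodMk_nhds hg)))))
  have hv : rescaledDzbar 1 1 1 0 0 0 = -4 := by norm_num [rescaledDzbar]
  simpa only [hv, Function.comp_def] using h

/-! ### Asymptotics of the midpoints -/

lemma midpoint_mem {n : ℕ} (hn : 1 ≤ n) :
    radius (n + 1) < midpoint n ∧ midpoint n < radius n := by
  have h := deltaRadius_pos hn
  have e : deltaRadius n = radius n - radius (n + 1) := rfl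
  constructor <;> rw [midpoint] <;> linarith

lemma midpoint_pos {n : ℕ} (hn : 1 ≤ n) : 0 < midpoint n :=
  (radius_pos (by omega)).trans (midpoint_mem hn).1

lemma tendsto_radius : Tendsto radius atTop (𝓝 0) := by
  unfold radius
  simp only [one_div]
  exact (Real.tendsto_log_atTop.comp
    (tendsto_atTop_add_const_right _ 1 tendsto_natCast_atTop_atTop)).inv_tendsto_atTop

lemma tendsto_midpoint : Tendsto midpoint atTop (𝓝 0) := by
  refine squeeze_zero' ?_ ?_ tendsto_radius
  · filter_upwards [eventually_ge_atTop 1] with n hn using (midpoint_pos hn).le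
  · filter_upwards [eventually_ge_atTop 1] with n hn using (midpoint_mem hn).2.le

lemma tendsto_exp_div_log (c : ℝ) :
    Tendsto (fun n : ℕ => Real.exp (c / Real.log ((n : ℝ) + 1))) atTop (𝓝 1) := by
  have h : Tendsto (fun n : ℕ => c * radius n) atTop (𝓝 0) := by
    simpa using tendsto_radius.const_mul c
  have := (Real.continuous_exp.tendsto 0).comp h
  rw [Real.exp_zero] at this
  refine this.congr fun n => ?_
  simp [radius, div_eq_mul_inv]

lemma one_le_midpoint_mul_log {n : ℕ} (hn : 1 ≤ n) {c : ℝ} (hc : 1 ≤ c) :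
    1 ≤ midpoint n * Real.log ((n : ℝ) + 1 + c) := by
  refine (one_le_mul_log (midpoint_mem hn).1.le).trans ?_
  refine mul_le_mul_of_nonneg_left ?_ (midpoint_pos hn).le
  exact Real.log_le_log (by positivity) (by linarith)

lemma tendsto_midpoint_mul_log_pow {c : ℝ} (hc : 1 ≤ c) :
    Tendsto (fun n : ℕ => (midpoint n * Real.log ((n : ℝ) + 1 + c)) ^ (2 * n)) atTop (𝓝 1) := by
  refine tendsto_of_tendsto_of_tendsto_of_le_of_le' tendsto_const_nhds
    (tendsto_exp_div_log (2 * c)) ?_ ?_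
  · filter_upwards [eventually_ge_atTop 1] with n hn
    exact one_le_pow₀ (one_le_midpoint_mul_log hn hc)
  · filter_upwards [eventually_ge_atTop 1] with n hn
    exact pow_mul_log_le hn (midpoint_pos hn).le (midpoint_mem hn).2.le (by linarith)

lemma tendsto_midpoint_mul_log_pow_sub :
    Tendsto (fun n : ℕ => (midpoint n * Real.log ((n : ℝ) + 2)) ^ (2 * (n - 1)))
      atTop (𝓝 1) := by
  refine tendsto_of_tendsto_of_tendsto_of_le_of_le' tendsto_const_nhds
    (tendsto_midpoint_mul_log_pow (c := 1) le_rfl) ?_ ?_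
  · filter_upwards [eventually_ge_atTop 1] with n hn
    exact one_le_pow₀ (one_le_mul_log (midpoint_mem hn).1.le)
  · filter_upwards [eventually_ge_atTop 1] with n hn
    rw [show (n : ℝ) + 1 + 1 = n + 2 by ring]
    exact pow_le_pow_right₀ (one_le_mul_log (midpoint_mem hn).1.le) (by omega)

lemma tendsto_midpoint_mul_log_add_two :
    Tendsto (fun n : ℕ => midpoint n * Real.log ((n : ℝ) + 2)) atTop (𝓝 1) := by
  refine tendsto_of_tendsto_of_tendsto_of_le_of_le' tendsto_const_nhds
    (tendsto_midpoint_mul_log_pow (c := 1) le_rfl) ?_ ?_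
  · filter_upwards [eventually_ge_atTop 1] with n hn
    exact one_le_mul_log (midpoint_mem hn).1.le
  · filter_upwards [eventually_ge_atTop 1] with n hn
    rw [show (n : ℝ) + 1 + 1 = n + 2 by ring]
    exact le_self_pow₀ (one_le_mul_log (midpoint_mem hn).1.le) (by omega)

lemma tendsto_log_add_two_sub_log_add_one :
    Tendsto (fun n : ℕ => Real.log ((n : ℝ) + 2) - Real.log ((n : ℝ) + 1)) atTop (𝓝 0) := by
  refine (Real.tendsto_log_nat_add_one_sub_log.comp (tendsto_add_atTop_nat 1)).congr fun n => ?_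
  simp only [Function.comp_apply]
  push_cast
  ring_nf

lemma tendsto_midpoint_mul_log_add_one :
    Tendsto (fun n : ℕ => midpoint n * Real.log ((n : ℝ) + 1)) atTop (𝓝 1) := by
  have h := tendsto_midpoint_mul_log_add_two.sub
    (tendsto_midpoint.mul tendsto_log_add_two_sub_log_add_one)
  rw [mul_zero, sub_zero] at h
  exact h.congr fun n => by ring

lemma tendsto_midpoint_mul_log :
    Tendsto (fun n : ℕ => midpoint n * Real.log (n : ℝ)) atTop (𝓝 1) := by
  have h := tendsto_midpoint_mul_log_add_one.sub
    (tendsto_midpoint.mul Real.tendsto_log_nat_add_one_sub_log)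
  rw [mul_zero, sub_zero] at h
  exact h.congr fun n => by ring

lemma tendsto_mul_log_sub_log :
    Tendsto (fun n : ℕ => (n : ℝ) * (Real.log ((n : ℝ) + 2) - Real.log ((n : ℝ) + 1)))
      atTop (𝓝 1) := by
  refine tendsto_of_tendsto_of_tendsto_of_le_of_le (tendsto_natCast_div_add_atTop (2 : ℝ))
    (tendsto_natCast_div_add_atTop (1 : ℝ)) (fun n => ?_) (fun n => ?_)
  · have := mul_le_mul_of_nonneg_left (one_div_le_log_sub_log n) (n.cast_nonneg (α := ℝ))
    rwa [mul_one_div] at this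
  · have h := log_add_le (n := n) (c := 1) zero_le_one
    rw [show (n : ℝ) + 1 + 1 = n + 2 by ring] at h
    have := mul_le_mul_of_nonneg_left (sub_le_iff_le_add'.2 h) (n.cast_nonneg (α := ℝ))
    rwa [mul_one_div] at this

lemma tendsto_sq_midpoint_div :
    Tendsto (fun n : ℕ => midpoint n ^ 2 / (n * deltaRadius n)) atTop (𝓝 1) := by
  have h := (tendsto_midpoint_mul_log_add_one.mul tendsto_midpoint_mul_log_add_two).div
    tendsto_mul_log_sub_log one_ne_zero
  rw [mul_one, div_one] at h
  refine h.congr' ?_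
  filter_upwards [eventually_ge_atTop 1] with n hn
  have h1 := log_succ_pos hn
  have h2 : Real.log ((n : ℝ) + 1) ≤ Real.log ((n : ℝ) + 2) :=
    Real.log_le_log (by positivity) (by linarith)
  have h2' : 0 < Real.log ((n : ℝ) + 2) := by linarith
  have h3 := one_div_le_log_sub_log n
  have h4 : (0 : ℝ) < 1 / ((n : ℝ) + 2) := by positivity
  have h5 : Real.log ((n : ℝ) + 2) - Real.log ((n : ℝ) + 1) ≠ 0 := by linarith
  have hn' : (n : ℝ) ≠ 0 := by positivity
  simp only [Pi.div_apply]
  rw [deltaRadius_eq hn]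
  field_simp

lemma tendsto_one_div_mul_midpoint :
    Tendsto (fun n : ℕ => 1 / ((n : ℝ) * midpoint n)) atTop (𝓝 0) := by
  have h1 : Tendsto (fun n : ℕ => Real.log ((n : ℝ) + 2) / ((n : ℝ) + 2)) atTop (𝓝 0) :=
    Real.isLittleO_log_id_atTop.tendsto_div_nhds_zero.comp
      (tendsto_atTop_add_const_right _ 2 tendsto_natCast_atTop_atTop)
  have h2 := h1.const_mul 3
  rw [mul_zero] at h2
  refine squeeze_zero' ?_ ?_ h2
  · filter_upwards [eventually_ge_atTop 1] with n hn
    have := midpoint_pos hn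
    positivity
  · filter_upwards [eventually_ge_atTop 1] with n hn
    have hn' : (1 : ℝ) ≤ n := by exact_mod_cast hn
    have h := midpoint_pos hn
    have h3 := one_le_mul_log (midpoint_mem hn).1.le
    rw [← mul_div_assoc, div_le_div_iff₀ (by positivity) (by positivity)]
    nlinarith

/-! ### The exact derivative and its growth -/

lemma midpoint_arg {n : ℕ} (hn : 1 ≤ n) :
    (midpoint n - radius (n + 1)) / deltaRadius n = 1 / 2 := by
  have := (deltaRadius_pos hn).ne'
  rw [midpoint]; field_simp; ring

lemma extendedProfile_half (hs : IsCutoffProfile s) : extendedProfile s (1 / 2) = 1 / 2 := by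
  rw [extendedProfile_eq hs (by norm_num) (by norm_num), hs.half]

lemma deriv_extendedProfile_half (hs : IsCutoffProfile s) :
    deriv (extendedProfile s) (1 / 2) = 2 := by
  rw [(extendedProfile_eventuallyEq hs (by norm_num) (by norm_num)).deriv_eq, hs.deriv_half]

lemma hasDerivAt_deriv_extendedProfile_half (hs : IsCutoffProfile s) :
    HasDerivAt (deriv (extendedProfile s)) 0 (1 / 2) := by
  have h := (extendedProfile_eventuallyEq hs (x := 1 / 2) (by norm_num) (by norm_num)).deriv
  have hd : DifferentiableAt ℝ (deriv s) (1 / 2) :=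
    ((contDiff_infty_iff_deriv.1 hs.smooth).2.differentiable (by simp)).differentiableAt
  have := hd.hasDerivAt
  rw [hs.deriv_deriv_half] at this
  exact this.congr_of_eventuallyEq h

lemma chi_midpoint (hs : IsCutoffProfile s) {n : ℕ} (hn : 1 ≤ n) :
    chi (extendedProfile s) n (midpoint n) = 1 / 2 := by
  rw [chi, norm_real, Real.norm_of_nonneg (midpoint_pos hn).le, midpoint_arg hn,
    extendedProfile_half hs]

lemma chiDeriv_midpoint (hs : IsCutoffProfile s) {n : ℕ} (hn : 1 ≤ n) :
    chiDeriv (extendedProfile s) n (midpoint n) = 2 / deltaRadius n := by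
  rw [chiDeriv, midpoint_arg hn, deriv_extendedProfile_half hs]

lemma hasDerivAt_chiDeriv_midpoint (hs : IsCutoffProfile s) {n : ℕ} (hn : 1 ≤ n) :
    HasDerivAt (chiDeriv (extendedProfile s) n) 0 (midpoint n) := by
  have h1 := hasDerivAt_deriv_extendedProfile_half hs
  rw [← midpoint_arg hn] at h1
  have h2 := (h1.comp (midpoint n) (((hasDerivAt_id (midpoint n)).sub_const
    (radius (n + 1))).div_const (deltaRadius n))).div_const (deltaRadius n)
  exact h2.congr_deriv (by simp)

/-- The factor `χ_n' / (2 |z|)` common to both Wirtinger derivatives of `χ_n`. -/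
noncomputable def radialFactor (t : ℝ → ℝ) (n : ℕ) (r : ℝ) : ℝ := chiDeriv t n r / (2 * r)

lemma radialFactor_midpoint (hs : IsCutoffProfile s) {n : ℕ} (hn : 1 ≤ n) :
    radialFactor (extendedProfile s) n (midpoint n) = 1 / deltaRadius n / midpoint n := by
  have := (midpoint_pos hn).ne'
  rw [radialFactor, chiDeriv_midpoint hs hn]; field_simp

lemma hasWirtingerAt_radialFactor_midpoint (hs : IsCutoffProfile s) {n : ℕ} (hn : 1 ≤ n) :
    HasWirtingerAt (fun z => (radialFactor (extendedProfile s) n ‖z‖ : ℂ))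
      (-(1 / deltaRadius n / (2 * midpoint n ^ 2)) : ℝ)
      (-(1 / deltaRadius n / (2 * midpoint n ^ 2)) : ℝ) (midpoint n) := by
  have hx := midpoint_pos hn
  have hx0 : (midpoint n : ℂ) ≠ 0 := by exact_mod_cast hx.ne'
  have hnorm : ‖(midpoint n : ℂ)‖ = midpoint n := by
    rw [norm_real, Real.norm_of_nonneg hx.le]
  have h1 := (hasDerivAt_chiDeriv_midpoint hs hn).div ((hasDerivAt_id (midpoint n)).const_mul 2)
    (by simpa using hx.ne')
  have h2 : HasDerivAt (radialFactor (extendedProfile s) n)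
      (-(1 / deltaRadius n / midpoint n ^ 2)) (midpoint n) := by
    refine HasDerivAt.congr_deriv h1 ?_
    simp only [id, chiDeriv_midpoint hs hn]
    field_simp
    ring
  rw [← hnorm] at h2
  have h3 := HasWirtingerAt.radial hx0 h2
  simp only [hnorm, conj_ofReal] at h3
  refine h3.congr ?_ ?_ <;> push_cast <;> field_simp

lemma blendDzbar_eq (t : ℝ → ℝ) (n : ℕ) (z : ℂ) :
    blendDzbar t n z = radialFactor t n ‖z‖ * z * gap n z := by
  rw [blendDzbar, radialFactor]; push_cast; ring

lemma blendDz_eq (t : ℝ → ℝ) (n : ℕ) (z : ℂ) :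
    blendDz t n z = radialFactor t n ‖z‖ * conj z * gap n z
      + (chi t n z * monomialDz (n - 1) z + (1 - chi t n z) * monomialDz (n + 1) z) := by
  rw [blendDz, radialFactor]; push_cast; ring

lemma monomialPart_ofReal (n : ℕ) (x : ℝ) :
    monomialPart n x = (F n * x ^ n ^ 2 : ℝ) := by
  rw [monomialPart, p]; push_cast; rfl

lemma monomialDz_ofReal {n : ℕ} (hn : 1 ≤ n) {x : ℝ} (hx : x ≠ 0) :
    monomialDz n x = ((n : ℝ) ^ 2 * (F n * x ^ n ^ 2) / x : ℝ) := by
  have hx' : (x : ℂ) ≠ 0 := by exact_mod_cast hx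
  obtain ⟨k, hk⟩ : ∃ k, n ^ 2 = k + 1 := ⟨n ^ 2 - 1, by have := Nat.one_le_pow 2 n hn; omega⟩
  rw [monomialDz, p, hk, show (n : ℝ) ^ 2 = (k + 1 : ℕ) by exact_mod_cast hk]
  push_cast
  field_simp
  ring

lemma hasWirtingerAt_monomialDz_ofReal {n : ℕ} (hn : 1 ≤ n) {x : ℝ} (hx : x ≠ 0) :
    HasWirtingerAt (monomialDz n)
      ((n : ℝ) ^ 2 * ((n : ℝ) ^ 2 - 1) * (F n * x ^ n ^ 2) / x ^ 2 : ℝ) 0 x := by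
  have hx' : (x : ℂ) ≠ 0 := by exact_mod_cast hx
  have h := HasWirtingerAt.monomial (F n * p n) x (p n - 1)
  have e : monomialDz n = fun w => (F n : ℂ) * p n * w ^ (p n - 1) := by
    ext w; rw [monomialDz, mul_assoc]
  rw [e]
  refine h.congr ?_ rfl
  obtain ⟨k, hk⟩ : ∃ k, n ^ 2 = k + 1 := ⟨n ^ 2 - 1, by have := Nat.one_le_pow 2 n hn; omega⟩
  rw [p, hk, show (n : ℝ) ^ 2 = (k + 1 : ℕ) by exact_mod_cast hk, Nat.add_sub_cancel]
  rcases k with _ | k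
  · simp
  · push_cast
    field_simp
    ring

/-- The exact value of `∂q₂₂/∂z̄` at the midpoint of an even annulus, multiplied by `x_n ^ 3`.
There `χ_n = 1/2`, `χ_n' = 2 / Δr_n` and `χ_n'' = 0`. -/
lemma dzbar_q_midpoint (hs : IsCutoffProfile s) {n : ℕ} (hn : 2 ≤ n) (he : Even n) :
    dzbar (q s 1 1) (midpoint n) * midpoint n ^ 3 =
      (rescaledDzbar ((midpoint n * Real.log ((n : ℝ) + 2)) ^ (2 * (n - 1)))⁻¹
        ((midpoint n * Real.log ((n : ℝ) + 1 + 2)) ^ (2 * n))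
        (midpoint n ^ 2 / (n * deltaRadius n)) (midpoint n) (1 / n)
        (1 / (n * midpoint n)) : ℝ) := by
  have hn1 : 1 ≤ n := by omega
  have hN : (n : ℝ) ≠ 0 := by positivity
  have hΔ := deltaRadius_pos hn1
  have hlog : 1 ≤ midpoint n * Real.log ((n : ℝ) + 2) := one_le_mul_log (midpoint_mem hn1).1.le
  have hκ := hasWirtingerAt_radialFactor_midpoint hs hn1
  have hκ0 := radialFactor_midpoint hs hn1
  have hχ0 := chi_midpoint hs hn1
  have hx := midpoint_pos hn1
  have hxC : (midpoint n : ℂ) ≠ 0 := by exact_mod_cast hx.ne'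
  have hχ := hasWirtingerAt_chi (contDiff_extendedProfile hs) n hxC
  have hmem : ∀ᶠ z in 𝓝 (midpoint n : ℂ), z ∈ annulus n := by
    have h1 : ‖(midpoint n : ℂ)‖ ∈ Set.Ioo (radius (n + 1)) (radius n) := by
      rw [norm_real, Real.norm_of_nonneg hx.le]; exact midpoint_mem hn1
    filter_upwards [continuous_norm.continuousAt.eventually (isOpen_Ioo.mem_nhds h1)] with z hz
    exact ⟨hz.1.le, hz.2.le⟩
  have hq : q s 1 1 =ᶠ[𝓝 (midpoint n : ℂ)] fun z =>
      blendDzbar (extendedProfile s) n z * conj (blendDz (extendedProfile s) n z)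
        / (monomialDz n z * conj (monomialDz n z)
          + blendDz (extendedProfile s) n z * conj (blendDz (extendedProfile s) n z)) := by
    filter_upwards [hmem] with z hz
    rw [q, if_neg (ne_zero_of_mem_annulus hn1 hz), normSqDz_eq hs hn1 hz, dz_u hs hn1 hz,
      dzbar_u hs hn1 hz, Complex.mul_conj', Complex.mul_conj']
    simp [monomialIndex, he]
  have hnorm : ‖(midpoint n : ℂ)‖ = midpoint n := by
    rw [norm_real, Real.norm_of_nonneg hx.le]
  have hχ' := hχ.congr (a' := (1 / deltaRadius n : ℝ)) (b' := (1 / deltaRadius n : ℝ))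
    (by simp only [hnorm, chiDeriv_midpoint hs hn1, conj_ofReal]; push_cast; field_simp)
    (by simp only [hnorm, chiDeriv_midpoint hs hn1]; push_cast; field_simp)
  set x := midpoint n with hxdef
  -- `A`, `M`, `B` are the three consecutive monomials at the midpoint.
  set D := 1 / deltaRadius n with hD
  set A := F (n - 1) * x ^ (n - 1) ^ 2 with hA
  set B := F (n + 1) * x ^ (n + 1) ^ 2 with hB
  set M := F n * x ^ n ^ 2 with hM
  have hM0 : 0 < M := mul_pos (F_pos n) (pow_pos hx _)
  have hcast : ((n - 1 : ℕ) : ℝ) = n - 1 := by push_cast [hn1]; ring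
  have hcast' : ((n + 1 : ℕ) : ℝ) = n + 1 := by push_cast; ring
  have hg := hasWirtingerAt_gap n x
  have hg0 : gap n x = (A - B : ℝ) := by
    rw [gap, monomialPart_ofReal, monomialPart_ofReal, ← hA, ← hB, ofReal_sub]
  have hdA : monomialDz (n - 1) x = (((n : ℝ) - 1) ^ 2 * A / x : ℝ) := by
    rw [monomialDz_ofReal (by omega) hx.ne', hcast]
  have hdB : monomialDz (n + 1) x = (((n : ℝ) + 1) ^ 2 * B / x : ℝ) := by
    rw [monomialDz_ofReal (by omega) hx.ne', hcast']
  have hddA := hasWirtingerAt_monomialDz_ofReal (n := n - 1) (by omega) hx.ne'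
  have hddB := hasWirtingerAt_monomialDz_ofReal (n := n + 1) (by omega) hx.ne'
  rw [hcast, ← hA] at hddA
  rw [hcast', ← hB] at hddB
  have hV : HasWirtingerAt (blendDzbar (extendedProfile s) n)
      ((D / (2 * x) * (A - B) + D * (((n : ℝ) - 1) ^ 2 * A - ((n : ℝ) + 1) ^ 2 * B) / x : ℝ))
      ((-(D / (2 * x)) * (A - B) : ℝ)) x := by
    have h := (hκ.mul (HasWirtingerAt.id (x : ℂ))).mul hg
    simp only [hnorm, hκ0, hg0, hdA, hdB] at h
    rw [funext (blendDzbar_eq (extendedProfile s) n)]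
    refine h.congr ?_ ?_ <;> push_cast <;> field_simp <;> ring
  have hW : HasWirtingerAt (blendDz (extendedProfile s) n)
      ((-(D / (2 * x)) * (A - B)
        + 2 * D * (((n : ℝ) - 1) ^ 2 * A - ((n : ℝ) + 1) ^ 2 * B) / x
        + (((n : ℝ) - 1) ^ 2 * (((n : ℝ) - 1) ^ 2 - 1) * A
          + ((n : ℝ) + 1) ^ 2 * (((n : ℝ) + 1) ^ 2 - 1) * B) / (2 * x ^ 2) : ℝ))
      ((D / (2 * x) * (A - B)
        + D * (((n : ℝ) - 1) ^ 2 * A - ((n : ℝ) + 1) ^ 2 * B) / x : ℝ)) x := by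
    have h := ((hκ.mul (HasWirtingerAt.id (x : ℂ)).star).mul hg).add
      ((hχ'.mul hddA).add (((HasWirtingerAt.const 1 (x : ℂ)).sub hχ').mul hddB))
    simp only [hnorm, hκ0, hg0, hdA, hdB, hχ0, conj_ofReal, map_one, map_zero] at h
    rw [funext (blendDz_eq (extendedProfile s) n)]
    refine h.congr ?_ ?_ <;> push_cast <;> field_simp <;> ring
  have hU := hasWirtingerAt_monomialDz_ofReal hn1 hx.ne'
  have hU0 := monomialDz_ofReal hn1 hx.ne'
  rw [← hM] at hU hU0
  have hV0 : blendDzbar (extendedProfile s) n x = (D * (A - B) : ℝ) := by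
    rw [blendDzbar_eq, hnorm, hκ0, hg0]; push_cast; field_simp
  have hW0 : blendDz (extendedProfile s) n x =
      (D * (A - B) + (((n : ℝ) - 1) ^ 2 * A + ((n : ℝ) + 1) ^ 2 * B) / (2 * x) : ℝ) := by
    rw [blendDz_eq, hnorm, hκ0, hg0, hdA, hdB, hχ0, conj_ofReal]; push_cast; field_simp; ring
  obtain ⟨a, h⟩ := hasWirtingerAt_quotient hV hW hU hV0 hW0 hU0
    (by positivity)
  have hdisk : (x : ℂ) ∈ disk (radius 1) := annulus_subset_disk hn1 hmem.self_of_nhds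
  rw [h.dzbar_eq hdisk (hq.filter_mono nhdsWithin_le_nhds)]
  have hAM : A = ((x * Real.log ((n : ℝ) + 2)) ^ (2 * (n - 1)))⁻¹ * M / x := by
    have h1 := F_mul_pow_succ (n - 1) x
    rw [Nat.sub_add_cancel hn1, hcast, show (n : ℝ) - 1 + 3 = n + 2 by ring, ← hM, ← hA] at h1
    have : (x * Real.log ((n : ℝ) + 2)) ^ (2 * (n - 1)) ≠ 0 := pow_ne_zero _ (by linarith)
    rw [h1]; field_simp
  have hBM : B = (x * Real.log ((n : ℝ) + 1 + 2)) ^ (2 * n) * M * x := by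
    have h1 := F_mul_pow_succ n x
    rw [hB, h1, show (n : ℝ) + 1 + 2 = n + 3 by ring, ← hM]; ring
  have hDn : D = x ^ 2 / (n * deltaRadius n) * n / x ^ 2 := by rw [hD]; field_simp
  have hspec := rescaledDzbar_spec hx.ne' hN hM0.ne' hAM hBM hDn rfl rfl rfl rfl rfl rfl rfl
  rw [← hspec]
  push_cast
  rfl

lemma tendsto_dzbar_q_mul (hs : IsCutoffProfile s) :
    Tendsto (fun m : ℕ => ‖dzbar (q s 1 1) (midpoint (2 * m))‖
      / Real.log ((2 * m : ℕ) : ℝ) ^ 3) atTop (𝓝 4) := by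
  have h2 : Tendsto (fun m : ℕ => 2 * m) atTop atTop := tendsto_id.const_mul_atTop' (by norm_num)
  have hα := tendsto_midpoint_mul_log_pow_sub.inv₀ one_ne_zero
  rw [inv_one] at hα
  have h := (tendsto_rescaledDzbar hα (tendsto_midpoint_mul_log_pow (c := 2) (by norm_num))
    tendsto_sq_midpoint_div tendsto_midpoint tendsto_one_div_atTop_nhds_zero_nat
    tendsto_one_div_mul_midpoint).comp h2
  have h3 := h.abs.div ((tendsto_midpoint_mul_log.comp h2).pow 3) (by norm_num)
  rw [show |(-4 : ℝ)| / 1 ^ 3 = 4 by norm_num] at h3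
  refine h3.congr' ?_
  filter_upwards [eventually_ge_atTop 1] with m hm
  have hx := midpoint_pos (n := 2 * m) (by omega)
  have hq := dzbar_q_midpoint hs (n := 2 * m) (by omega) (even_two_mul m)
  have hq' := congrArg norm hq
  rw [norm_mul, norm_pow, norm_real, norm_real, Real.norm_of_nonneg hx.le, Real.norm_eq_abs]
    at hq'
  simp only [Function.comp_apply, Pi.div_apply]
  rw [← hq', mul_pow, mul_comm, mul_div_mul_left _ _ (by positivity)]

lemma tendsto_log_two_mul_pow :
    Tendsto (fun m : ℕ => Real.log ((2 * m : ℕ) : ℝ) ^ 3) atTop atTop := by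
  have h2 : Tendsto (fun m : ℕ => 2 * m) atTop atTop := tendsto_id.const_mul_atTop' (by norm_num)
  exact (tendsto_pow_atTop (by norm_num)).comp
    (Real.tendsto_log_atTop.comp (tendsto_natCast_atTop_atTop.comp h2))

lemma tendsto_norm_dzbar_q_atTop (hs : IsCutoffProfile s) :
    Tendsto (fun m : ℕ => ‖dzbar (q s 1 1) (midpoint (2 * m))‖) atTop atTop := by
  refine ((tendsto_dzbar_q_mul hs).pos_mul_atTop (by norm_num)
    tendsto_log_two_mul_pow).congr' ?_
  filter_upwards [tendsto_log_two_mul_pow.eventually_gt_atTop 0] with m hm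
  exact div_mul_cancel₀ _ hm.ne'

/-- A Lipschitz bound near an interior point of the disk bounds `∂/∂z̄` there. -/
lemma norm_dzbar_le_of_lipschitzOnWith {f : ℂ → ℂ} {K : NNReal} {r : ℝ} {z : ℂ}
    (hf : LipschitzOnWith K f (disk r)) (hz : ‖z‖ < r) (hr : r ≤ radius 1) :
    ‖dzbar f z‖ ≤ K := by
  have hmem (ρ : ℝ) (hρ : ‖z‖ < ρ) : disk ρ ∈ 𝓝 z := by
    filter_upwards [continuous_norm.continuousAt.eventually (Iio_mem_nhds hρ)] with w hw
      using le_of_lt hw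
  have h := norm_fderiv_le_of_lipschitzOn ℝ (hmem r hz) hf
  rw [dzbar, fderivWithin_of_mem_nhds (hmem _ (hz.trans_le hr)), norm_div]
  have h1 := (fderiv ℝ f z).le_of_opNorm_le h 1
  have h2 := (fderiv ℝ f z).le_of_opNorm_le h I
  have h3 := norm_add_le (fderiv ℝ f z 1) (I * fderiv ℝ f z I)
  rw [norm_mul, norm_I] at h3
  rw [norm_I] at h2
  rw [norm_one] at h1
  norm_num
  linarith

lemma not_lipschitzOnWith_q (hs : IsCutoffProfile s) {r : ℝ} (hr : 0 < r) (hr1 : r < radius 1) :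
    ¬ ∃ K : NNReal, LipschitzOnWith K (q s 1 1) (disk r) := by
  rintro ⟨K, hK⟩
  have h2 : Tendsto (fun m : ℕ => 2 * m) atTop atTop := tendsto_id.const_mul_atTop' (by norm_num)
  obtain ⟨m, hm1, hm2, hm3⟩ := ((eventually_ge_atTop 1).and
    (((tendsto_midpoint.comp h2).eventually_lt_const hr).and
      ((tendsto_norm_dzbar_q_atTop hs).eventually_gt_atTop (K : ℝ)))).exists
  refine hm3.not_ge (norm_dzbar_le_of_lipschitzOnWith hK ?_ hr1.le)
  rwa [norm_real, Real.norm_of_nonneg (midpoint_pos (by omega)).le]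

end FlatBeltrami

theorem theorem4p1 (s : ℝ → ℝ) (hs : FlatBeltrami.IsCutoffProfile s) :
    (∀ i j : Fin 2,
      ContDiffOn ℝ ∞ (FlatBeltrami.q s i j)
        (FlatBeltrami.disk (FlatBeltrami.radius 1) \ {0}) ∧
      ContinuousOn (FlatBeltrami.q s i j) (FlatBeltrami.disk (FlatBeltrami.radius 1)) ∧
      (∀ k : ℕ, Filter.Tendsto (fun z : ℂ => ‖z ^ (-(k : ℤ)) * FlatBeltrami.q s i j z‖)
        (nhdsWithin 0 {0}ᶜ) (nhds 0)) ∧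
      HasDerivAt (fun t : ℝ => FlatBeltrami.q s i j (t : ℂ)) 0 0 ∧
      HasDerivAt (fun t : ℝ => FlatBeltrami.q s i j ((t : ℂ) * Complex.I)) 0 0) ∧
    (∀ r : ℝ, 0 < r → r < FlatBeltrami.radius 1 →
      ¬ ∃ K : NNReal, LipschitzOnWith K (FlatBeltrami.q s 1 1) (FlatBeltrami.disk r)) ∧
    Filter.Tendsto FlatBeltrami.midpoint Filter.atTop (nhds 0) ∧
    Asymptotics.IsTheta Filter.atTop
      (fun m : ℕ =>
        ‖FlatBeltrami.dzbar (FlatBeltrami.q s 1 1) (FlatBeltrami.midpoint (2 * m) : ℂ)‖)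
      (fun m : ℕ => Real.log ((2 * m : ℕ) : ℝ) ^ 3) := by
  refine ⟨fun i j => ⟨FlatBeltrami.contDiffOn_q hs i j, FlatBeltrami.continuousOn_q hs i j,
    FlatBeltrami.tendsto_zpow_mul_q hs i j, ?_, FlatBeltrami.hasDerivAt_q_comp hs i j
      Complex.I_ne_zero⟩, fun r hr hr1 => FlatBeltrami.not_lipschitzOnWith_q hs hr hr1,
    FlatBeltrami.tendsto_midpoint, ?_⟩
  · simpa using FlatBeltrami.hasDerivAt_q_comp hs i j one_ne_zero
  · exact (Asymptotics.isTheta_of_div_tendsto_nhds_ne_zero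
      (FlatBeltrami.tendsto_dzbar_q_mul hs) (by norm_num)).symm
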